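/- Let $n\ge 2$, let $\overline{\mathbb R}^n=\mathbb R^n\cup\{\infty\}$ be the one-point compactification of $\mathbb R^n$, and let $G\subset\overline{\mathbb R}^n$ be a domain (a non-empty connected open set) whose boundary $\partial G$ in $\overline{\mathbb R}^n$ has at least two points. Then $\partial G$ is uniformly perfect if and only if there exists a constant $b>0$ such that $$\mu_G(x,y)\ \ge\ b\,\delta_G(x,y)\qquad\text{for all }x,y\in G .$$ Here the notions are as follows. (a) A compact set $E\subset\overline{\mathbb R}^n$ with at least two points is *uniformly perfect* if there is a constant $c\in(0,1)$ such that $E$ meets the closed annulus $\{x\in\mathbb R^n: cr\le|x-a|\le r\}$ whenever $a\in E\setminus\{\infty\}$ and $0<r<\operatorname{diam}(E)$, where $\operatorname{diam}(E)$ is the Euclidean diameter of $E$, and $\operatorname{diam}(E)=+\infty$ if $\infty\in E$. (b) *Seittenranta's Möbius metric* is $\delta_G(x,y)=\log\bigl(1+\sup_{a,b\in\partial G}|a,x,b,y|\bigr)$, where $|a,b,c,d|=\dfrac{|a-c|\,|b-d|}{|a-b|\,|c-d|}$ is the absolute (cross) ratio, understood as the corresponding limit if one of the points is $\infty$ (and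 as $0$ if $a=c$ or $b=d$). (c) The *modulus metric* is $\mu_G(x,y)=\inf_{C}\mathsf M(\Delta(C,\partial G;G))$, where the infimum runs over all curves $C$ in $G$ joining $x$ and $y$. Here $\Delta(E,F;G)$ is the family of all curves $\gamma:[\alpha,\beta]\to\overline{\mathbb R}^n$ with $\gamma(\alpha)\in E$, $\gamma(\beta)\in F$ and $\gamma((\alpha,\beta))\subset G$, and the conformal modulus of a curve family $\Gamma$ is $\mathsf M(\Gamma)=\inf_\rho\int_{\mathbb R^n}\rho^n\,dm$, with $m$ the $n$-dimensional Lebesgue measure, the infimum being over all Borel functions $\rho:\mathbb R^n\to[0,+\infty]$ such that $\int_\gamma\rho\,ds\ge1$ for every (locally) rectifiable curve $\gamma\in\Gamma$ ($\mathsf M(\Gamma)=+\infty$ if there is none); curves through $\infty$ have infinite length and impose no condition. -/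

import Mathlib

open Set MeasureTheory
open scoped ENNReal unitInterval

noncomputable section

/-- Euclidean `n`-space. -/
abbrev Rn (n : ℕ) : Type := EuclideanSpace ℝ (Fin n)

/-- The Möbius space: the one-point compactification of Euclidean `n`-space. -/
abbrev MobiusSpace (n : ℕ) : Type := OnePoint (Rn n)

/-- A domain: a non-empty connected open subset of the Möbius space. -/
def IsMobiusDomain {n : ℕ} (G : Set (MobiusSpace n)) : Prop :=
  IsOpen G ∧ IsConnected G

/-! ### Uniformly perfect sets -/

open Classical in
/-- The Euclidean diameter of a subset of the Möbius space, `∞` if the set contains the point at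
infinity. -/
def euclideanDiam {n : ℕ} (E : Set (MobiusSpace n)) : ℝ≥0∞ :=
  if OnePoint.infty ∈ E then ⊤ else Metric.ediam {x : Rn n | (x : MobiusSpace n) ∈ E}

/-- A compact set `E` with at least two points is uniformly perfect if for some `c ∈ (0, 1)` it
meets each closed annulus `c r ≤ |x - a| ≤ r` with `a ∈ E` finite and `0 < r < diam E`. -/
def IsUniformlyPerfect {n : ℕ} (E : Set (MobiusSpace n)) : Prop :=
  IsCompact E ∧ E.Nontrivial ∧
    ∃ c : ℝ, 0 < c ∧ c < 1 ∧
      ∀ a : Rn n, (a : MobiusSpace n) ∈ E →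
        ∀ r : ℝ, 0 < r → ENNReal.ofReal r < euclideanDiam E →
          ∃ x : Rn n, (x : MobiusSpace n) ∈ E ∧ c * r ≤ dist x a ∧ dist x a ≤ r

/-! ### The Möbius metric -/

/-- The factor `|x - y|` of an absolute ratio. A factor in which exactly one point is infinite
counts as `1`: in an absolute ratio each point occurs in one factor of the numerator and in one
factor of the denominator, and the quotient of these two tends to `1` as the point tends to
infinity. -/
def ratioFactor {n : ℕ} : MobiusSpace n → MobiusSpace n → ℝ
  | some x, some y => dist x y
  | some _, none => 1
  | none, some _ => 1
  | none, none => 0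

/-- The absolute (cross) ratio `|a, b, c, d| = |a - c| |b - d| / (|a - b| |c - d|)`, with its
limit values if one of the points is infinite. -/
def absoluteRatio {n : ℕ} (a b c d : MobiusSpace n) : ℝ :=
  (ratioFactor a c * ratioFactor b d) / (ratioFactor a b * ratioFactor c d)

/-- `m_G(x, y)`, the supremum of `|a, x, b, y|` over all boundary points `a`, `b` of `G`. -/
def supAbsoluteRatio {n : ℕ} (G : Set (MobiusSpace n)) (x y : MobiusSpace n) : ℝ :=
  sSup {t : ℝ | ∃ a ∈ frontier G, ∃ b ∈ frontier G, t = absoluteRatio a x b y}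

/-- Seittenranta's Möbius metric `δ_G(x, y) = log (1 + m_G(x, y))`. -/
def mobiusMetric {n : ℕ} (G : Set (MobiusSpace n)) (x y : MobiusSpace n) : ℝ :=
  Real.log (1 + supAbsoluteRatio G x y)

/-! ### The conformal modulus of a curve family -/

/-- A (closed) curve in the Möbius space, parametrized by the unit interval. -/
abbrev Curve (n : ℕ) : Type := C(I, MobiusSpace n)

/-- A curve in Euclidean space, seen as a curve in the Möbius space. -/
def finiteCurve {n : ℕ} (γ : C(I, Rn n)) : Curve n :=
  ⟨fun t => (γ t : MobiusSpace n), OnePoint.continuous_coe.comp γ.continuous⟩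

/-- The Euclidean length of a curve. -/
def curveLength {n : ℕ} (γ : C(I, Rn n)) : ℝ≥0∞ := eVariationOn γ univ

/-- The line integral `∫_γ ρ ds` over a rectifiable curve: the integral of `ρ` along the
parametrization of `γ` by arc length. -/
def lineIntegral {n : ℕ} (ρ : Rn n → ℝ≥0∞) (γ : C(I, Rn n)) : ℝ≥0∞ :=
  ∫⁻ s in Icc (0 : ℝ) (curveLength γ).toReal, ρ (naturalParameterization γ univ 0 s)

/-- Admissible functions for a family `Γ` of curves. A curve with a compact parameter interval is
locally rectifiable iff it has finite Euclidean length; such a curve does not pass through the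
point at infinity. -/
def IsAdmissible {n : ℕ} (Γ : Set (Curve n)) (ρ : Rn n → ℝ≥0∞) : Prop :=
  Measurable ρ ∧
    ∀ γ : C(I, Rn n), finiteCurve γ ∈ Γ → curveLength γ ≠ ⊤ → 1 ≤ lineIntegral ρ γ

/-- The conformal modulus of a curve family, `∞` if there is no admissible function. -/
def conformalModulus {n : ℕ} (Γ : Set (Curve n)) : ℝ≥0∞ :=
  ⨅ (ρ : Rn n → ℝ≥0∞) (_ : IsAdmissible Γ ρ), ∫⁻ x, ρ x ^ n

/-- `Δ(E, F; G)`: the family of all curves joining `E` and `F` in `G`. -/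
def joiningCurves {n : ℕ} (E F G : Set (MobiusSpace n)) : Set (Curve n) :=
  {γ | γ 0 ∈ E ∧ γ 1 ∈ F ∧ ∀ t : I, 0 < t → t < 1 → γ t ∈ G}

/-- The modulus metric `μ_G(x, y)`: the infimum of the moduli of `Δ(C, ∂G; G)` over all curves
`C` in `G` joining `x` and `y`. -/
def modulusMetric {n : ℕ} (G : Set (MobiusSpace n)) (x y : MobiusSpace n) : ℝ≥0∞ :=
  ⨅ (γ : Path x y) (_ : range γ ⊆ G), conformalModulus (joiningCurves (range γ) (frontier G) G)

end

/-!
Suppose first that `∂G` is not uniformly perfect. Then there are arbitrarily fat rings around points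
of `∂G` which miss `∂G` but separate it, and such a ring lies in `G`. Two antipodal points of its
middle sphere have Möbius distance at least `log 2`, while a curve from this sphere to `∂G` has to
cross one half of the ring. The density `ρ(z) = const / (N |z - a|)` then shows that the modulus
distance of the two points tends to `0` as the ring becomes fatter.

Conversely, a uniformly perfect boundary carries at each of its points and each scale a probability
measure `ν` with `ν (closedBall q t) ≤ const * t ^ β` for some `β > 0`: the image of the
coin-tossing measure under a binary tree of boundary points. A connected set carries such measures
as well. If `ρ` is admissible for the curves from a continuum `C` to `∂G`, its integral is at least
`1` along each polygon which runs from `C` through a point `w` to `∂G`. Averaging over the two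
end points with respect to these measures and over `w` in a ball, Hölder's inequality bounds
`∫ ρⁿ` over one spherical ring from below by a constant. Summing over the disjoint rings around the
boundary point nearest to `x` gives a lower bound of order `log (1 + R / dist x ∂G)`, where `R` is
the smaller of `|x - y|` and the diameter of `∂G`, and `δ_G(x, y)` is at most the sum of two such
logarithms, one for `x` and one for `y`.
-/

noncomputable section

/-! ### Arc length -/

section ArcLength

lemma continuous_variationOnFromTo {α E : Type*} [LinearOrder α] [TopologicalSpace α]
    [OrderTopology α] [PseudoMetricSpace E] {f : α → E} (hf : Continuous f)
    (hbv : LocallyBoundedVariationOn f univ) (a : α) :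
    Continuous (variationOnFromTo f univ a) := by
  refine continuous_iff_continuousAt.2 fun t => continuousAt_iff_continuous_left'_right'.2 ⟨?_, ?_⟩
  · simpa [ContinuousWithinAt] using variationOnFromTo.tendsto_left (mem_univ a) (mem_univ t) hbv
      (l := f t) hf.continuousWithinAt
  · simpa [ContinuousWithinAt] using variationOnFromTo.tendsto_right (mem_univ a) (mem_univ t) hbv
      (l := f t) hf.continuousWithinAt

lemma image_variationOnFromTo {E : Type*} [PseudoMetricSpace E] {γ : I → E} (hγ : Continuous γ)
    (hbv : BoundedVariationOn γ univ) :
    variationOnFromTo γ univ 0 '' univ = Icc 0 (eVariationOn γ univ).toReal := by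
  have hzero : variationOnFromTo γ univ 0 0 = 0 := variationOnFromTo.self _ _ _
  have hone : variationOnFromTo γ univ 0 1 = (eVariationOn γ univ).toReal := by
    rw [variationOnFromTo.eq_of_le _ _ zero_le_one, univ_inter,
      show Icc (0 : I) 1 = univ from eq_univ_of_forall fun t => ⟨t.2.1, t.2.2⟩]
  have hmono := variationOnFromTo.monotoneOn hbv.locallyBoundedVariationOn (mem_univ (0 : I))
  rw [← hzero, ← hone]
  apply Subset.antisymm
  · rintro _ ⟨t, -, rfl⟩
    exact ⟨hmono (mem_univ _) (mem_univ _) t.2.1, hmono (mem_univ _) (mem_univ _) t.2.2⟩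
  · rw [image_univ]
    exact fun s hs => mem_range_of_exists_le_of_exists_ge
      (continuous_variationOnFromTo hγ hbv.locallyBoundedVariationOn 0) ⟨0, hs.1⟩ ⟨1, hs.2⟩

lemma lipschitzOnWith_one_of_hasUnitSpeedOn {E : Type*} [PseudoEMetricSpace E] {f : ℝ → E}
    {s : Set ℝ} (hf : HasUnitSpeedOn f s) : LipschitzOnWith 1 f s := by
  have hle : ∀ x ∈ s, ∀ y ∈ s, x ≤ y → edist (f x) (f y) ≤ edist x y := fun x hx y hy hxy => by
    calc edist (f x) (f y) ≤ eVariationOn f (s ∩ Icc x y) :=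
          eVariationOn.edist_le f ⟨hx, le_rfl, hxy⟩ ⟨hy, hxy, le_rfl⟩
      _ = edist x y := by
          rw [hf hx hy, edist_comm, edist_dist, Real.dist_eq, abs_of_nonneg (sub_nonneg.2 hxy),
            NNReal.coe_one, one_mul]
  intro x hx y hy
  rw [ENNReal.coe_one, one_mul]
  rcases le_total x y with hxy | hyx
  · exact hle x hx y hy hxy
  · simpa only [edist_comm] using hle y hy x hx hyx

/-- The parametrization of `γ` by arc length on `[0, L]`, `L` the length of `γ`, extended by
constants to `ℝ` so that it is globally `1`-Lipschitz. -/
def arcLengthParam {E : Type*} [PseudoEMetricSpace E] (γ : I → E) (s : ℝ) : E :=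
  naturalParameterization γ univ 0
    (projIcc 0 (eVariationOn γ univ).toReal ENNReal.toReal_nonneg s)

/-- The arc length measure of `γ`, carried by the trace of `γ` and counted with multiplicity. -/
def arcLengthMeasure {E : Type*} [PseudoEMetricSpace E] [MeasurableSpace E] (γ : I → E) :
    Measure E :=
  (volume.restrict (Icc 0 (eVariationOn γ univ).toReal)).map (arcLengthParam γ)

lemma arcLengthParam_of_mem {E : Type*} [PseudoEMetricSpace E] {γ : I → E} {s : ℝ}
    (hs : s ∈ Icc 0 (eVariationOn γ univ).toReal) :
    arcLengthParam γ s = naturalParameterization γ univ 0 s := by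
  rw [arcLengthParam, projIcc_of_mem _ hs]

section

variable {E : Type*} [MetricSpace E] {γ : I → E}

lemma lipschitzWith_arcLengthParam (hγ : Continuous γ) (hbv : BoundedVariationOn γ univ) :
    LipschitzWith 1 (arcLengthParam γ) := by
  have hspeed := has_unit_speed_naturalParameterization γ hbv.locallyBoundedVariationOn (mem_univ 0)
  rw [image_variationOnFromTo hγ hbv] at hspeed
  have hlip := (lipschitzOnWith_one_of_hasUnitSpeedOn hspeed).to_restrict.comp
    (LipschitzWith.projIcc ENNReal.toReal_nonneg)
  rwa [one_mul] at hlip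

lemma exists_arcLengthParam_eq (hγ : Continuous γ) (hbv : BoundedVariationOn γ univ) (t : I) :
    ∃ s ∈ Icc 0 (eVariationOn γ univ).toReal, arcLengthParam γ s = γ t := by
  have hmem : variationOnFromTo γ univ 0 t ∈ Icc 0 (eVariationOn γ univ).toReal :=
    image_variationOnFromTo hγ hbv ▸ mem_image_of_mem _ (mem_univ t)
  refine ⟨_, hmem, (arcLengthParam_of_mem hmem).trans (edist_eq_zero.1 ?_)⟩
  exact edist_naturalParameterization_eq_zero hbv.locallyBoundedVariationOn (mem_univ _)
    (mem_univ _)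

/-- The half-open spherical shell `α < |z - a| ≤ β`. -/
def shell (a : E) (α β : ℝ) : Set E := {z | dist z a ∈ Ioc α β}

variable [MeasurableSpace E] [OpensMeasurableSpace E]

lemma measurableSet_shell (a : E) (α β : ℝ) : MeasurableSet (shell a α β) :=
  (continuous_id.dist continuous_const).measurable measurableSet_Ioc

-- The distance to the centre is `1`-Lipschitz in arc length and takes all values in `(α, β]`.
lemma ofReal_sub_le_arcLengthMeasure_shell [BorelSpace E] (hγ : Continuous γ)
    (hbv : BoundedVariationOn γ univ) (a : E) {α β : ℝ} {t₁ t₂ : I} (hα : dist (γ t₁) a ≤ α)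
    (hβ : β ≤ dist (γ t₂) a) : ENNReal.ofReal (β - α) ≤ arcLengthMeasure γ (shell a α β) := by
  have hlip := lipschitzWith_arcLengthParam hγ hbv
  set S := arcLengthParam γ ⁻¹' shell a α β ∩ Icc 0 (eVariationOn γ univ).toReal
  have hdist : LipschitzWith 1 fun s => dist (arcLengthParam γ s) a := by
    simpa only [one_mul, Function.comp_def] using (LipschitzWith.dist_left a).comp hlip
  have hcover : Ioc α β ⊆ (fun s => dist (arcLengthParam γ s) a) '' S := by
    intro u hu
    obtain ⟨t, ht⟩ := (isPreconnected_range (hγ.dist continuous_const)).ordConnected.out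
      (mem_range_self t₁) (mem_range_self t₂) ⟨hα.trans hu.1.le, hu.2.trans hβ⟩
    obtain ⟨s, hs, hst⟩ := exists_arcLengthParam_eq hγ hbv t
    have hsu : dist (arcLengthParam γ s) a = u := by rw [hst]; exact ht
    exact ⟨s, ⟨show dist _ a ∈ Ioc α β from hsu ▸ hu, hs⟩, hsu⟩
  calc ENNReal.ofReal (β - α) = volume (Ioc α β) := Real.volume_Ioc.symm
    _ ≤ volume ((fun s => dist (arcLengthParam γ s) a) '' S) := measure_mono hcover
    _ ≤ volume S := by
        simpa [hausdorffMeasure_real] using hdist.hausdorffMeasure_image_le (d := 1) zero_le_one S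
    _ = arcLengthMeasure γ (shell a α β) := by
        rw [arcLengthMeasure, Measure.map_apply hlip.continuous.measurable
          (measurableSet_shell a α β), Measure.restrict_apply
          (hlip.continuous.measurable (measurableSet_shell a α β))]

end

lemma lineIntegral_eq_lintegral_arcLengthMeasure {n : ℕ} {ρ : Rn n → ℝ≥0∞} (hρ : Measurable ρ)
    {γ : C(I, Rn n)} (hγ : curveLength γ ≠ ⊤) :
    lineIntegral ρ γ = ∫⁻ z, ρ z ∂arcLengthMeasure γ := by
  rw [arcLengthMeasure,
    lintegral_map hρ (lipschitzWith_arcLengthParam γ.continuous hγ).continuous.measurable]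
  exact setLIntegral_congr_fun measurableSet_Icc fun s hs => by rw [arcLengthParam_of_mem hs]

end ArcLength

/-! ### Curves crossing a ring -/

section Ring

variable {n : ℕ}

-- Geometrically growing radii, rather than a continuum of spheres, replace polar coordinates.
lemma lintegral_shell_eq_sum {E : Type*} [MetricSpace E] [MeasurableSpace E]
    [OpensMeasurableSpace E] (μ : Measure E) (f : E → ℝ≥0∞) (a : E) {b s : ℝ} (hb : 1 ≤ b)
    (hs : 0 ≤ s) (m M : ℕ) :
    ∫⁻ z in shell a (b ^ m * s) (b ^ M * s), f z ∂μ =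
      ∑ k ∈ Finset.Ico m M, ∫⁻ z in shell a (b ^ k * s) (b ^ (k + 1) * s), f z ∂μ := by
  have hmono : Monotone fun k : ℕ => b ^ k * s := fun i j hij =>
    mul_le_mul_of_nonneg_right (pow_le_pow_right₀ hb hij) hs
  have hunion : shell a (b ^ m * s) (b ^ M * s) =
      ⋃ k ∈ Finset.Ico m M, shell a (b ^ k * s) (b ^ (k + 1) * s) := by
    ext z
    simpa only [mem_iUnion, Finset.mem_Ico, mem_Ico, Nat.succ_eq_succ, Nat.succ_eq_add_one,
      shell, mem_ofPred_eq] using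
      (Set.ext_iff.1 (hmono.biUnion_Ico_Ioc_map_succ m M) (dist z a)).symm
  rw [hunion, lintegral_biUnion_finset _ fun k _ => measurableSet_shell a _ _]
  exact fun i _ j _ hij => (hmono.pairwise_disjoint_on_Ioc_succ hij).preimage (dist · a)

/-- The density `2 / (N |z - a|)` on the ring `s < |z - a| ≤ 4 ^ N s`. It integrates to at least
`1` along any curve crossing one of the two halves into which the sphere of radius `2 ^ N s` cuts
the ring. -/
def ringDensity (N : ℕ) (a : Rn n) (s : ℝ) : Rn n → ℝ≥0∞ :=
  (shell a s (2 ^ (2 * N) * s)).indicator fun z => ENNReal.ofReal (2 / (N * dist z a))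

lemma measurable_ringDensity (N : ℕ) (a : Rn n) (s : ℝ) : Measurable (ringDensity N a s) :=
  Measurable.indicator (by fun_prop) (measurableSet_shell a _ _)

lemma volume_shell_le (a : Rn n) {α β : ℝ} (hβ : 0 ≤ β) :
    volume (shell a α β) ≤ ENNReal.ofReal (β ^ n) * volume (Metric.ball (0 : Rn n) 1) := by
  calc volume (shell a α β) ≤ volume (Metric.closedBall a β) := measure_mono fun z hz => hz.2
    _ = _ := by rw [Measure.addHaar_closedBall _ _ hβ, finrank_euclideanSpace_fin]

lemma setLIntegral_ofReal_div_dist_pow_le {N : ℕ} (hN : 0 < N) (a : Rn n) {r : ℝ} (hr : 0 < r) :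
    ∫⁻ z in shell a r (2 * r), ENNReal.ofReal (2 / (N * dist z a)) ^ n ≤
      ENNReal.ofReal ((4 / N) ^ n) * volume (Metric.ball (0 : Rn n) 1) := by
  calc ∫⁻ z in shell a r (2 * r), ENNReal.ofReal (2 / (N * dist z a)) ^ n
      ≤ ∫⁻ _ in shell a r (2 * r), ENNReal.ofReal ((2 / (N * r)) ^ n) := by
        refine setLIntegral_mono' (measurableSet_shell a _ _) fun z hz => ?_
        have hrz : r ≤ dist z a := hz.1.le
        rw [← ENNReal.ofReal_pow (by positivity)]
        gcongr
    _ ≤ ENNReal.ofReal ((2 / (N * r)) ^ n) *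
          (ENNReal.ofReal ((2 * r) ^ n) * volume (Metric.ball (0 : Rn n) 1)) := by
        rw [setLIntegral_const]
        gcongr
        exact volume_shell_le a (by positivity)
    _ = ENNReal.ofReal ((4 / N) ^ n) * volume (Metric.ball (0 : Rn n) 1) := by
        rw [← mul_assoc, ← ENNReal.ofReal_mul (by positivity), ← mul_pow]
        congr 3
        field_simp
        norm_num

lemma lintegral_ringDensity_pow_le (hn : 2 ≤ n) {N : ℕ} (hN : 0 < N) (a : Rn n) {s : ℝ}
    (hs : 0 < s) :
    ∫⁻ z, ringDensity N a s z ^ n ≤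
      ENNReal.ofReal (2 * 4 ^ n / N) * volume (Metric.ball (0 : Rn n) 1) := by
  have hN1 : (1 : ℝ) ≤ N := by exact_mod_cast hN
  have hpow : ∀ z, ringDensity N a s z ^ n = (shell a s (2 ^ (2 * N) * s)).indicator
      (fun z => ENNReal.ofReal (2 / (N * dist z a)) ^ n) z := fun z =>
    (congrFun (indicator_comp_of_zero (g := (· ^ n)) (zero_pow (by omega))) z).symm
  have hconst : (2 * N : ℝ) * (4 / N) ^ n ≤ 2 * 4 ^ n / N := by
    rw [div_pow, mul_div_assoc', div_le_div_iff₀ (by positivity) (by positivity)]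
    calc (2 * N * 4 ^ n * N : ℝ) = 2 * 4 ^ n * N ^ 2 := by ring
      _ ≤ 2 * 4 ^ n * N ^ n := by gcongr
  calc ∫⁻ z, ringDensity N a s z ^ n
      = ∑ k ∈ Finset.Ico 0 (2 * N), ∫⁻ z in shell a (2 ^ k * s) (2 ^ (k + 1) * s),
          ENNReal.ofReal (2 / (N * dist z a)) ^ n := by
        simp only [hpow]
        rw [lintegral_indicator (measurableSet_shell a _ _),
          ← lintegral_shell_eq_sum volume _ a one_le_two hs.le, pow_zero, one_mul]
    _ ≤ ∑ _k ∈ Finset.Ico 0 (2 * N),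
          ENNReal.ofReal ((4 / N) ^ n) * volume (Metric.ball (0 : Rn n) 1) :=
        Finset.sum_le_sum fun k _ => by
          simpa only [pow_succ', mul_assoc] using
            setLIntegral_ofReal_div_dist_pow_le hN a (r := 2 ^ k * s) (by positivity)
    _ = ENNReal.ofReal (2 * N * (4 / N) ^ n) * volume (Metric.ball (0 : Rn n) 1) := by
        rw [Finset.sum_const, Nat.card_Ico, Nat.sub_zero, nsmul_eq_mul, ← mul_assoc,
          ENNReal.ofReal_mul (by positivity), ← ENNReal.ofReal_natCast, Nat.cast_mul,
          Nat.cast_ofNat]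
    _ ≤ _ := by gcongr

lemma le_setLIntegral_ofReal_div_dist (μ : Measure (Rn n)) {N : ℕ} (hN : 0 < N) {a : Rn n} {r : ℝ}
    (hr : 0 < r) (hμ : ENNReal.ofReal r ≤ μ (shell a r (2 * r))) :
    ENNReal.ofReal (1 / N) ≤ ∫⁻ z in shell a r (2 * r), ENNReal.ofReal (2 / (N * dist z a)) ∂μ := by
  calc ENNReal.ofReal (1 / N) = ENNReal.ofReal (1 / (N * r)) * ENNReal.ofReal r := by
        rw [← ENNReal.ofReal_mul (by positivity)]
        congr 1
        field_simp
    _ ≤ ENNReal.ofReal (1 / (N * r)) * μ (shell a r (2 * r)) := by gcongr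
    _ = ∫⁻ _ in shell a r (2 * r), ENNReal.ofReal (1 / (N * r)) ∂μ :=
        (setLIntegral_const _ _).symm
    _ ≤ _ := setLIntegral_mono' (measurableSet_shell a _ _) fun z hz => by
        have hpos : 0 < dist z a := hr.trans hz.1
        refine ENNReal.ofReal_le_ofReal ?_
        rw [div_le_div_iff₀ (by positivity) (by positivity)]
        nlinarith [hz.2, (Nat.cast_pos (α := ℝ)).2 hN]

lemma one_le_lintegral_ringDensity (μ : Measure (Rn n)) {N m : ℕ} (hN : 0 < N) (hm : m ≤ N)
    {a : Rn n} {s : ℝ} (hs : 0 < s)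
    (hμ : ∀ k ∈ Finset.Ico m (m + N),
      ENNReal.ofReal (2 ^ k * s) ≤ μ (shell a (2 ^ k * s) (2 ^ (k + 1) * s))) :
    1 ≤ ∫⁻ z, ringDensity N a s z ∂μ := by
  have hsub : shell a (2 ^ m * s) (2 ^ (m + N) * s) ⊆ shell a s (2 ^ (2 * N) * s) := fun z hz =>
    Ioc_subset_Ioc (le_mul_of_one_le_left hs.le (one_le_pow₀ one_le_two))
      (mul_le_mul_of_nonneg_right (pow_le_pow_right₀ one_le_two (by omega)) hs.le) hz
  calc (1 : ℝ≥0∞) = ∑ _k ∈ Finset.Ico m (m + N), ENNReal.ofReal (1 / N) := by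
        rw [Finset.sum_const, Nat.card_Ico, add_tsub_cancel_left, nsmul_eq_mul,
          ← ENNReal.ofReal_natCast, ← ENNReal.ofReal_mul (by positivity),
          mul_one_div_cancel (by positivity), ENNReal.ofReal_one]
    _ ≤ ∑ k ∈ Finset.Ico m (m + N), ∫⁻ z in shell a (2 ^ k * s) (2 ^ (k + 1) * s),
          ENNReal.ofReal (2 / (N * dist z a)) ∂μ := Finset.sum_le_sum fun k hk => by
        have hμk := hμ k hk
        rw [pow_succ', mul_assoc] at hμk ⊢
        exact le_setLIntegral_ofReal_div_dist μ hN (by positivity) hμk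
    _ = ∫⁻ z in shell a (2 ^ m * s) (2 ^ (m + N) * s), ENNReal.ofReal (2 / (N * dist z a)) ∂μ :=
        (lintegral_shell_eq_sum μ _ a one_le_two hs.le m (m + N)).symm
    _ ≤ ∫⁻ z in shell a s (2 ^ (2 * N) * s), ENNReal.ofReal (2 / (N * dist z a)) ∂μ :=
        lintegral_mono_set hsub
    _ = _ := (lintegral_indicator (measurableSet_shell a _ _) _).symm

lemma one_le_lineIntegral_ringDensity {N : ℕ} (hN : 0 < N) {a : Rn n} {s : ℝ}
    (hs : 0 < s) {γ : C(I, Rn n)} (hγ : curveLength γ ≠ ⊤) (hstart : dist (γ 0) a = 2 ^ N * s)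
    (hend : dist (γ 1) a ≤ s ∨ 2 ^ (2 * N) * s ≤ dist (γ 1) a) :
    1 ≤ lineIntegral (ringDensity N a s) γ := by
  have hmono : ∀ {i j : ℕ}, i ≤ j → (2 : ℝ) ^ i * s ≤ 2 ^ j * s := fun hij =>
    mul_le_mul_of_nonneg_right (pow_le_pow_right₀ one_le_two hij) hs.le
  have hcross : ∀ k {t₁ t₂ : I}, dist (γ t₁) a ≤ 2 ^ k * s → 2 ^ (k + 1) * s ≤ dist (γ t₂) a →
      ENNReal.ofReal (2 ^ k * s) ≤ arcLengthMeasure γ (shell a (2 ^ k * s) (2 ^ (k + 1) * s)) := by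
    intro k t₁ t₂ h₁ h₂
    have hwidth : (2 : ℝ) ^ k * s = 2 ^ (k + 1) * s - 2 ^ k * s := by ring
    exact (congrArg ENNReal.ofReal hwidth).trans_le
      (ofReal_sub_le_arcLengthMeasure_shell γ.continuous hγ a h₁ h₂)
  rw [lineIntegral_eq_lintegral_arcLengthMeasure (measurable_ringDensity N a s) hγ]
  rcases hend with hinner | houter
  · refine one_le_lintegral_ringDensity _ hN N.zero_le hs fun k hk => ?_
    rw [Finset.mem_Ico] at hk
    exact hcross k (hinner.trans (le_mul_of_one_le_left hs.le (one_le_pow₀ one_le_two)))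
      ((hmono (by omega)).trans hstart.ge)
  · refine one_le_lintegral_ringDensity _ hN le_rfl hs fun k hk => ?_
    rw [Finset.mem_Ico] at hk
    exact hcross k (hstart.trans_le (hmono hk.1)) ((hmono (by omega)).trans houter)

lemma conformalModulus_le_of_ring (hn : 2 ≤ n) {N : ℕ} (hN : 0 < N) {a : Rn n} {s : ℝ}
    (hs : 0 < s) {Γ : Set (Curve n)}
    (hΓ : ∀ γ : C(I, Rn n), finiteCurve γ ∈ Γ → dist (γ 0) a = 2 ^ N * s ∧
      (dist (γ 1) a ≤ s ∨ 2 ^ (2 * N) * s ≤ dist (γ 1) a)) :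
    conformalModulus Γ ≤ ENNReal.ofReal (2 * 4 ^ n / N) * volume (Metric.ball (0 : Rn n) 1) :=
  calc conformalModulus Γ ≤ ∫⁻ z, ringDensity N a s z ^ n :=
        iInf₂_le _ ⟨measurable_ringDensity N a s, fun γ hγ hlen =>
          one_le_lineIntegral_ringDensity hN hs hlen (hΓ γ hγ).1 (hΓ γ hγ).2⟩
    _ ≤ _ := lintegral_ringDensity_pow_le hn hN a hs

end Ring

/-! ### Rings separating the boundary -/

section Topology

lemma isOpen_coe_ball {X : Type*} [MetricSpace X] (a : X) (r : ℝ) :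
    IsOpen ((↑) '' Metric.ball a r : Set (OnePoint X)) :=
  OnePoint.isOpen_image_coe.2 Metric.isOpen_ball

lemma isOpen_compl_coe_closedBall {X : Type*} [MetricSpace X] [ProperSpace X] (a : X) (r : ℝ) :
    IsOpen ((↑) '' Metric.closedBall a r : Set (OnePoint X))ᶜ :=
  OnePoint.isOpen_compl_image_coe.2 ⟨Metric.isClosed_closedBall, isCompact_closedBall a r⟩

lemma exists_dist_eq_of_isPreconnected {X : Type*} [MetricSpace X] [ProperSpace X]
    {K : Set (OnePoint X)} (hK : IsPreconnected K) {a p : X} {r : ℝ} (hp : (p : OnePoint X) ∈ K)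
    (hpr : dist p a ≤ r) {q : OnePoint X} (hq : q ∈ K) (hqr : ∀ z : X, q = z → r ≤ dist z a) :
    ∃ z : X, (z : OnePoint X) ∈ K ∧ dist z a = r := by
  by_contra! hsphere
  have hcover : K ⊆ (↑) '' Metric.ball a r ∪ ((↑) '' Metric.closedBall a r)ᶜ := by
    intro w hw
    rw [mem_union, or_iff_not_imp_right, notMem_compl_iff]
    rintro ⟨z, hz, rfl⟩
    exact ⟨z, lt_of_le_of_ne hz (hsphere z hw), rfl⟩
  have hq' : q ∉ (↑) '' Metric.closedBall a r := by
    rintro ⟨z, hz, rfl⟩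
    exact hsphere z hq (le_antisymm hz (hqr z rfl))
  obtain ⟨_, -, ⟨z, hz, rfl⟩, hz'⟩ := hK _ _ (isOpen_coe_ball a r)
    (isOpen_compl_coe_closedBall a r) hcover
    ⟨p, hp, p, lt_of_le_of_ne hpr (hsphere p hp), rfl⟩ ⟨q, hq, hq'⟩
  exact hz' ⟨z, Metric.ball_subset_closedBall hz, rfl⟩

lemma subset_of_isPreconnected_of_disjoint_frontier {X : Type*} [TopologicalSpace X] {K G : Set X}
    (hK : IsPreconnected K) (hG : IsOpen G) (hdisj : Disjoint K (frontier G))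
    (hne : (K ∩ G).Nonempty) : K ⊆ G := by
  refine hK.subset_left_of_subset_union hG isClosed_closure.isOpen_compl
    (disjoint_compl_right.mono_left subset_closure) (fun x hx => ?_) hne
  by_contra hout
  simp only [mem_union, mem_compl_iff, not_or, not_not] at hout
  exact hdisj.notMem_of_mem_left hx (hG.frontier_eq ▸ ⟨hout.2, hout.1⟩)

lemma isPreconnected_closed_annulus {E : Type*} [NormedAddCommGroup E] [NormedSpace ℝ E]
    (hrank : 1 < Module.rank ℝ E) (a : E) {s r : ℝ} (hs : 0 < s) :
    IsPreconnected {z : E | s ≤ dist z a ∧ dist z a ≤ r} := by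
  have hpolar := ((isPreconnected_sphere hrank (0 : E) 1).prod
    (isPreconnected_Icc (a := s) (b := r))).image (fun q : E × ℝ => a + q.2 • q.1) (by fun_prop)
  convert hpolar using 1
  ext z
  constructor
  · rintro ⟨hsz, hzr⟩
    rw [dist_eq_norm] at hsz hzr
    have hpos : ‖z - a‖ ≠ 0 := (hs.trans_le hsz).ne'
    exact ⟨(‖z - a‖⁻¹ • (z - a), ‖z - a‖), ⟨by simp [norm_smul, hpos], hsz, hzr⟩,
      by simp [smul_smul, hpos]⟩
  · rintro ⟨⟨u, t⟩, ⟨hu, ht⟩, rfl⟩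
    have hdist : dist (a + t • u) a = t := by
      rw [dist_eq_norm, add_sub_cancel_left, norm_smul, mem_sphere_zero_iff_norm.1 hu, mul_one,
        Real.norm_of_nonneg (hs.le.trans ht.1)]
    rwa [← hdist] at ht

lemma one_lt_rank_Rn {n : ℕ} (hn : 2 ≤ n) : 1 < Module.rank ℝ (Rn n) := by
  rw [← Module.finrank_eq_rank, finrank_euclideanSpace_fin]
  exact_mod_cast hn

/-- The closed ring `s ≤ |z - a| ≤ r` separates `E`: it misses `E`, and `E` contains both the centre
`a` and a point of the outer component of the complement, possibly `∞`. -/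
structure RingSeparates {n : ℕ} (E : Set (MobiusSpace n)) (a : Rn n) (s r : ℝ) : Prop where
  center_mem : (a : MobiusSpace n) ∈ E
  lt_dist : ∀ z : Rn n, (z : MobiusSpace n) ∈ E → s ≤ dist z a → r < dist z a
  exists_outer : ∃ q ∈ E, ∀ z : Rn n, q = z → r < dist z a

variable {n : ℕ} {G : Set (MobiusSpace n)}

lemma RingSeparates.mono_right {E : Set (MobiusSpace n)} {a : Rn n} {s r r' : ℝ}
    (hsep : RingSeparates E a s r) (hr : r' ≤ r) : RingSeparates E a s r' where
  center_mem := hsep.center_mem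
  lt_dist z hz hsz := hr.trans_lt (hsep.lt_dist z hz hsz)
  exists_outer := hsep.exists_outer.imp fun _ hq => ⟨hq.1, fun z hz => hr.trans_lt (hq.2 z hz)⟩

lemma RingSeparates.mem_domain (hn : 2 ≤ n) (hG : IsMobiusDomain G) {a : Rn n} {s r : ℝ}
    (hs : 0 < s) (hsr : s ≤ r) (hsep : RingSeparates (frontier G) a s r) {z : Rn n}
    (hz : s ≤ dist z a ∧ dist z a ≤ r) : (z : MobiusSpace n) ∈ G := by
  obtain ⟨q, hq, hqr⟩ := hsep.exists_outer
  obtain ⟨_, ⟨u, hus, rfl⟩, huG⟩ := mem_closure_iff.1 (frontier_subset_closure hsep.center_mem) _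
    (isOpen_coe_ball a s) ⟨a, Metric.mem_ball_self hs, rfl⟩
  obtain ⟨v, hvr, hvG⟩ := mem_closure_iff.1 (frontier_subset_closure hq) _
    (isOpen_compl_coe_closedBall a r) (by
      rintro ⟨w, hw, rfl⟩
      exact (hqr w rfl).not_ge hw)
  obtain ⟨w, hwG, hw⟩ : ∃ w : Rn n, (w : MobiusSpace n) ∈ G ∧ dist w a = s :=
    exists_dist_eq_of_isPreconnected hG.2.isPreconnected huG (Metric.mem_ball.1 hus).le hvG
      fun z hz => le_of_not_gt fun hlt => hvr ⟨z, hlt.le.trans hsr, hz.symm⟩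
  have hannulus : ((↑) '' {z : Rn n | s ≤ dist z a ∧ dist z a ≤ r} : Set (MobiusSpace n)) ⊆ G := by
    refine subset_of_isPreconnected_of_disjoint_frontier
      ((isPreconnected_closed_annulus (one_lt_rank_Rn hn) a hs).image _
        OnePoint.continuous_coe.continuousOn) hG.1 (disjoint_left.2 ?_)
      ⟨w, mem_image_of_mem _ ⟨hw.ge, hw.le.trans hsr⟩, hwG⟩
    rintro _ ⟨x, ⟨hsx, hxr⟩, rfl⟩ hx
    exact (hsep.lt_dist x hx hsx).not_ge hxr
  exact hannulus (mem_image_of_mem _ hz)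

lemma isUniformlyPerfect_of_forall_not_ringSeparates {E : Set (MobiusSpace n)} (hE : IsCompact E)
    (hnt : E.Nontrivial) {c : ℝ} (hc : 0 < c) (hc2 : c ≤ 1 / 2)
    (hsep : ∀ a : Rn n, ∀ r > 0, ¬ RingSeparates E a (c * r) r) : IsUniformlyPerfect E := by
  refine ⟨hE, hnt, c, hc, by linarith, fun a ha r hr hrE => ?_⟩
  by_contra! hmiss
  refine hsep a r hr ⟨ha, hmiss, ?_⟩
  by_contra! hinner
  have hinfty : OnePoint.infty ∉ E := fun h => by
    obtain ⟨z, hz, -⟩ := hinner _ h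
    exact OnePoint.infty_ne_coe _ hz
  have hball : ∀ z : Rn n, (z : MobiusSpace n) ∈ E → dist z a < c * r := fun z hz => by
    obtain ⟨z', hz', hle⟩ := hinner _ hz
    obtain rfl := OnePoint.coe_eq_coe.1 hz'
    exact lt_of_not_ge fun hge => (hmiss z hz hge).not_ge hle
  rw [euclideanDiam, if_neg hinfty] at hrE
  refine hrE.not_ge (Metric.ediam_le fun x hx y hy => ?_)
  rw [edist_dist]
  refine ENNReal.ofReal_le_ofReal ?_
  nlinarith [dist_triangle_right x y a, hball x hx, hball y hy]

end Topology

/-! ### The absolute ratio and the Möbius metric -/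

section Ratio

variable {n : ℕ}

lemma ratioFactor_self (x : MobiusSpace n) : ratioFactor x x = 0 := by
  induction x using OnePoint.rec with
  | infty => rfl
  | coe x => exact dist_self x

lemma ratioFactor_comm (x y : MobiusSpace n) : ratioFactor x y = ratioFactor y x := by
  induction x using OnePoint.rec <;> induction y using OnePoint.rec
  case coe.coe x y => exact dist_comm x y
  all_goals rfl

lemma ratioFactor_nonneg (x y : MobiusSpace n) : 0 ≤ ratioFactor x y := by
  induction x using OnePoint.rec <;> induction y using OnePoint.rec
  exacts [le_rfl, zero_le_one, zero_le_one, dist_nonneg]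

lemma absoluteRatio_coe (a x b y : Rn n) :
    absoluteRatio (a : MobiusSpace n) x b y = dist a b * dist x y / (dist a x * dist b y) := rfl

lemma absoluteRatio_infty_left (x b y : Rn n) :
    absoluteRatio (OnePoint.infty : MobiusSpace n) x b y = dist x y / dist b y := by
  change 1 * dist x y / (1 * dist b y) = _
  rw [one_mul, one_mul]

lemma absoluteRatio_infty_right (a x y : Rn n) :
    absoluteRatio (a : MobiusSpace n) x OnePoint.infty y = dist x y / dist a x := by
  change 1 * dist x y / (dist a x * 1) = _
  rw [one_mul, mul_one]

lemma absoluteRatio_self (a x y : MobiusSpace n) : absoluteRatio a x a y = 0 := by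
  rw [absoluteRatio, ratioFactor_self, zero_mul, zero_div]

lemma absoluteRatio_swap (a x b y : MobiusSpace n) :
    absoluteRatio a x b y = absoluteRatio b y a x := by
  rw [absoluteRatio, absoluteRatio, ratioFactor_comm a b, ratioFactor_comm x y,
    mul_comm (ratioFactor a x)]

lemma absoluteRatio_nonneg (a x b y : MobiusSpace n) : 0 ≤ absoluteRatio a x b y :=
  div_nonneg (mul_nonneg (ratioFactor_nonneg _ _) (ratioFactor_nonneg _ _))
    (mul_nonneg (ratioFactor_nonneg _ _) (ratioFactor_nonneg _ _))

lemma one_add_mul_div_mul_le {e d s t s' t' R : ℝ} (hs : 0 < s) (ht : 0 < t) (hs' : s ≤ s')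
    (ht' : t ≤ t') (he : 0 ≤ e) (hd : 0 ≤ d) (hR : d ≤ R ∨ e ≤ R)
    (hed : e ≤ s' + d + t') (hde : d ≤ s' + e + t') :
    1 + e * d / (s' * t') ≤ (1 + R / s) * (1 + R / t) := by
  have hs0 : 0 < s' := hs.trans_le hs'
  have ht0 : 0 < t' := ht.trans_le ht'
  have hR0 : 0 ≤ R := hR.elim hd.trans he.trans
  have hprod : e * d ≤ R * (s' + t' + R) := by rcases hR with h | h <;> nlinarith
  calc 1 + e * d / (s' * t') ≤ 1 + R * (s' + t' + R) / (s' * t') := by gcongr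
    _ = (1 + R / s') * (1 + R / t') := by field_simp; ring
    _ ≤ _ := by gcongr

-- `R` plays the part of `min |x - y| (diam ∂G)`; the second bound is only available when `a` and
-- `b` are both finite.
lemma one_add_absoluteRatio_le {x y : Rn n} {a b : MobiusSpace n} {s t R : ℝ} (hs : 0 < s)
    (ht : 0 < t) (ha : ∀ z : Rn n, a = z → s ≤ dist z x) (hb : ∀ z : Rn n, b = z → t ≤ dist z y)
    (hR : dist x y ≤ R ∨ ∃ a' b' : Rn n, a = a' ∧ b = b' ∧ dist a' b' ≤ R) :
    1 + absoluteRatio a x b y ≤ (1 + R / s) * (1 + R / t) := by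
  have hR0 : 0 ≤ R := by rcases hR with h | ⟨_, _, _, _, h⟩ <;> exact dist_nonneg.trans h
  have hRs : 0 ≤ R / s := by positivity
  have hRt : 0 ≤ R / t := by positivity
  induction a using OnePoint.rec with
  | infty =>
    have hxy : dist x y ≤ R := hR.resolve_right fun ⟨_, _, h, _⟩ => OnePoint.infty_ne_coe _ h
    induction b using OnePoint.rec with
    | infty =>
      rw [absoluteRatio_self]
      nlinarith
    | coe b =>
      have hle : dist x y / dist b y ≤ R / t := div_le_div₀ hR0 hxy ht (hb b rfl)
      rw [absoluteRatio_infty_left]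
      nlinarith
  | coe a =>
    induction b using OnePoint.rec with
    | infty =>
      have hxy : dist x y ≤ R :=
        hR.resolve_right fun ⟨_, _, _, h, _⟩ => OnePoint.infty_ne_coe _ h
      have hle : dist x y / dist a x ≤ R / s := div_le_div₀ hR0 hxy hs (ha a rfl)
      rw [absoluteRatio_infty_right]
      nlinarith
    | coe b =>
      rw [absoluteRatio_coe]
      refine one_add_mul_div_mul_le hs ht (ha a rfl) (hb b rfl) dist_nonneg dist_nonneg
        (hR.imp_right ?_) ?_ ?_
      · rintro ⟨a', b', ha', hb', h⟩
        rwa [OnePoint.coe_eq_coe.1 ha', OnePoint.coe_eq_coe.1 hb']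
      · simpa only [dist_comm y b] using dist_triangle4 a x y b
      · simpa only [dist_comm x a] using dist_triangle4 x a b y

lemma supAbsoluteRatio_nonneg (G : Set (MobiusSpace n)) (x y : MobiusSpace n) :
    0 ≤ supAbsoluteRatio G x y := by
  refine Real.sSup_nonneg ?_
  rintro _ ⟨a, -, b, -, rfl⟩
  exact absoluteRatio_nonneg a x b y

lemma mobiusMetric_nonneg (G : Set (MobiusSpace n)) (x y : MobiusSpace n) :
    0 ≤ mobiusMetric G x y :=
  Real.log_nonneg (le_add_of_nonneg_right (supAbsoluteRatio_nonneg G x y))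

lemma mobiusMetric_self (G : Set (MobiusSpace n)) (x : MobiusSpace n) : mobiusMetric G x x = 0 := by
  have hratio : ∀ t, (∃ a ∈ frontier G, ∃ b ∈ frontier G, t = absoluteRatio a x b x) → t = 0 := by
    rintro _ ⟨a, -, b, -, rfl⟩
    rw [absoluteRatio, ratioFactor_self, mul_zero, zero_div]
  have hsup : supAbsoluteRatio G x x = 0 := le_antisymm
    (Real.sSup_nonpos fun t ht => (hratio t ht).le) (Real.sSup_nonneg fun t ht => (hratio t ht).ge)
  rw [mobiusMetric, hsup, add_zero, Real.log_one]

lemma mobiusMetric_comm (G : Set (MobiusSpace n)) (x y : MobiusSpace n) :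
    mobiusMetric G x y = mobiusMetric G y x := by
  have hset : {t : ℝ | ∃ a ∈ frontier G, ∃ b ∈ frontier G, t = absoluteRatio a x b y} =
      {t : ℝ | ∃ a ∈ frontier G, ∃ b ∈ frontier G, t = absoluteRatio a y b x} := by
    ext t
    constructor <;> rintro ⟨a, ha, b, hb, rfl⟩ <;> exact ⟨b, hb, a, ha, absoluteRatio_swap _ _ _ _⟩
  rw [mobiusMetric, mobiusMetric, supAbsoluteRatio, supAbsoluteRatio, hset]

lemma mobiusMetric_le_log {G : Set (MobiusSpace n)} (hne : (frontier G).Nonempty)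
    {x y : MobiusSpace n} {m : ℝ}
    (hm : ∀ a ∈ frontier G, ∀ b ∈ frontier G, 1 + absoluteRatio a x b y ≤ m) :
    mobiusMetric G x y ≤ Real.log m := by
  obtain ⟨a, ha⟩ := hne
  have hnonneg := supAbsoluteRatio_nonneg G x y
  have hle : supAbsoluteRatio G x y ≤ m - 1 := by
    refine csSup_le ⟨_, a, ha, a, ha, rfl⟩ ?_
    rintro _ ⟨a, ha, b, hb, rfl⟩
    exact le_sub_iff_add_le'.2 (hm a ha b hb)
  exact Real.log_le_log (by linarith) (by linarith)

/-- The finite boundary points of `G`, as a subset of `ℝⁿ`. -/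
def finiteFrontier (G : Set (MobiusSpace n)) : Set (Rn n) :=
  {z | (z : MobiusSpace n) ∈ frontier G}

variable {G : Set (MobiusSpace n)}

lemma finiteFrontier_nonempty (hcard : (frontier G).Nontrivial) : (finiteFrontier G).Nonempty := by
  obtain ⟨w, hw, hne⟩ := hcard.exists_ne OnePoint.infty
  obtain ⟨z, rfl⟩ := OnePoint.ne_infty_iff_exists.1 hne
  exact ⟨z, hw⟩

lemma isClosed_finiteFrontier (G : Set (MobiusSpace n)) : IsClosed (finiteFrontier G) :=
  isClosed_frontier.preimage OnePoint.continuous_coe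

lemma disjoint_frontier_of_isOpen {X : Type*} [TopologicalSpace X] {s : Set X} (hs : IsOpen s) :
    Disjoint s (frontier s) :=
  disjoint_iff_inter_eq_empty.2 hs.inter_frontier_eq

lemma infDist_finiteFrontier_pos (hG : IsOpen G) (hne : (finiteFrontier G).Nonempty) {x : Rn n}
    (hx : (x : MobiusSpace n) ∈ G) : 0 < Metric.infDist x (finiteFrontier G) :=
  ((isClosed_finiteFrontier G).notMem_iff_infDist_pos hne).1
    ((disjoint_frontier_of_isOpen hG).notMem_of_mem_left hx)

lemma infDist_finiteFrontier_le (x : Rn n) {a : MobiusSpace n} (ha : a ∈ frontier G) (z : Rn n)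
    (haz : a = z) : Metric.infDist x (finiteFrontier G) ≤ dist z x := by
  rw [dist_comm]
  exact Metric.infDist_le_dist_of_mem (haz ▸ ha : (z : MobiusSpace n) ∈ frontier G)

lemma absoluteRatio_le_supAbsoluteRatio (hG : IsOpen G) (hne : (finiteFrontier G).Nonempty)
    {x y : Rn n} (hx : (x : MobiusSpace n) ∈ G) (hy : (y : MobiusSpace n) ∈ G)
    {a b : MobiusSpace n} (ha : a ∈ frontier G) (hb : b ∈ frontier G) :
    absoluteRatio a x b y ≤ supAbsoluteRatio G x y := by
  refine le_csSup ⟨(1 + dist x y / Metric.infDist x (finiteFrontier G)) *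
    (1 + dist x y / Metric.infDist y (finiteFrontier G)), ?_⟩ ⟨a, ha, b, hb, rfl⟩
  rintro _ ⟨a, ha, b, hb, rfl⟩
  linarith [one_add_absoluteRatio_le (infDist_finiteFrontier_pos hG hne hx)
    (infDist_finiteFrontier_pos hG hne hy) (infDist_finiteFrontier_le x ha)
    (infDist_finiteFrontier_le y hb) (Or.inl le_rfl)]

lemma one_le_absoluteRatio_antipodal {a u : Rn n} (hu : u ≠ 0) {q : MobiusSpace n}
    (hqy : q ≠ (a - u : Rn n)) (hqu : ∀ z : Rn n, q = z → ‖u‖ ≤ dist z a) :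
    1 ≤ absoluteRatio (a : MobiusSpace n) (a + u : Rn n) q (a - u : Rn n) := by
  have hu0 : 0 < ‖u‖ := norm_pos_iff.2 hu
  have hxy : dist (a + u) (a - u) = 2 * ‖u‖ := by
    rw [dist_eq_norm, show a + u - (a - u) = (2 : ℝ) • u by rw [two_smul]; abel, norm_smul,
      Real.norm_ofNat]
  have hax : dist a (a + u) = ‖u‖ := dist_self_add_right u a
  induction q using OnePoint.rec with
  | infty =>
    rw [absoluteRatio_infty_right, hxy, hax, le_div_iff₀ hu0]
    linarith
  | coe b =>
    have hby : 0 < dist b (a - u) := dist_pos.2 fun h => hqy (congrArg _ h)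
    have hab : dist b (a - u) ≤ dist a b + ‖u‖ := by
      simpa only [dist_comm b a, dist_self_sub_right] using dist_triangle b a (a - u)
    have hub : ‖u‖ ≤ dist a b := dist_comm b a ▸ hqu b rfl
    rw [absoluteRatio_coe, hxy, hax, le_div_iff₀ (by positivity)]
    nlinarith

end Ratio

/-! ### A lower bound for the modulus metric implies uniform perfectness -/

section Converse

variable {n : ℕ} {G : Set (MobiusSpace n)}

lemma log_two_le_mobiusMetric (hG : IsOpen G) {a u : Rn n} (hu : u ≠ 0) {s : ℝ}
    (hsep : RingSeparates (frontier G) a s ‖u‖) (hx : ((a + u : Rn n) : MobiusSpace n) ∈ G)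
    (hy : ((a - u : Rn n) : MobiusSpace n) ∈ G) :
    Real.log 2 ≤ mobiusMetric G (a + u : Rn n) (a - u : Rn n) := by
  obtain ⟨q, hq, hqu⟩ := hsep.exists_outer
  have hqy : q ≠ (a - u : Rn n) := fun h =>
    (disjoint_frontier_of_isOpen hG).notMem_of_mem_left hy (h ▸ hq)
  have hratio := (one_le_absoluteRatio_antipodal hu hqy fun z hz => (hqu z hz).le).trans
    (absoluteRatio_le_supAbsoluteRatio hG ⟨a, hsep.center_mem⟩ hx hy hsep.center_mem hq)
  exact Real.log_le_log two_pos (by linarith)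

lemma modulusMetric_le_of_ringSeparates (hn : 2 ≤ n) (hG : IsMobiusDomain G) {N : ℕ} (hN : 0 < N)
    {a : Rn n} {s : ℝ} (hs : 0 < s) (hsep : RingSeparates (frontier G) a s (2 ^ (2 * N) * s))
    {x y : Rn n} (hx : dist x a = 2 ^ N * s) (hy : dist y a = 2 ^ N * s) :
    modulusMetric G x y ≤
      ENNReal.ofReal (2 * 4 ^ n / N) * volume (Metric.ball (0 : Rn n) 1) := by
  have hinner : s ≤ 2 ^ N * s := le_mul_of_one_le_left hs.le (one_le_pow₀ one_le_two)
  have houter : 2 ^ N * s ≤ 2 ^ (2 * N) * s :=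
    mul_le_mul_of_nonneg_right (pow_le_pow_right₀ one_le_two (by omega)) hs.le
  obtain ⟨p, hp⟩ := (isPathConnected_sphere (one_lt_rank_Rn hn) a (hs.le.trans hinner)).joinedIn
    x hx y hy
  refine (iInf₂_le (p.map OnePoint.continuous_coe) ?_).trans
    (conformalModulus_le_of_ring hn hN (a := a) hs ?_)
  · rintro _ ⟨t, rfl⟩
    have ht : dist (p t) a = 2 ^ N * s := hp t
    exact hsep.mem_domain hn hG hs (hinner.trans houter) (ht ▸ ⟨hinner, houter⟩)
  · rintro γ ⟨⟨t, ht⟩, hend, -⟩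
    have hpt : p t = γ 0 := OnePoint.coe_eq_coe.1 ht
    refine ⟨hpt ▸ hp t, or_iff_not_imp_left.2 fun hlt => ?_⟩
    exact (hsep.lt_dist (γ 1) hend (not_le.1 hlt).le).le

lemma exists_pos_nat_ofReal_div_mul_lt (A : ℝ) {V : ℝ≥0∞} (hV : V ≠ ⊤) {ε : ℝ} (hε : 0 < ε) :
    ∃ N : ℕ, 0 < N ∧ ENNReal.ofReal (A / N) * V < ENNReal.ofReal ε := by
  have hlim : Filter.Tendsto (fun N : ℕ => ENNReal.ofReal (A / N) * V) Filter.atTop (nhds 0) := by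
    simpa using ENNReal.Tendsto.mul_const
      (ENNReal.tendsto_ofReal (tendsto_const_div_atTop_nhds_zero_nat A)) (Or.inr hV)
  exact ((Filter.eventually_gt_atTop 0).and
    (hlim.eventually_lt_const (ENNReal.ofReal_pos.2 hε))).exists

theorem isUniformlyPerfect_frontier_of_le_modulusMetric (hn : 2 ≤ n) (hG : IsMobiusDomain G)
    (hcard : (frontier G).Nontrivial) {b : ℝ} (hb : 0 < b)
    (hle : ∀ x ∈ G, ∀ y ∈ G, ENNReal.ofReal (b * mobiusMetric G x y) ≤ modulusMetric G x y) :
    IsUniformlyPerfect (frontier G) := by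
  obtain ⟨N, hN, hlt⟩ := exists_pos_nat_ofReal_div_mul_lt (2 * 4 ^ n)
    (V := volume (Metric.ball (0 : Rn n) 1)) measure_ball_lt_top.ne
    (mul_pos hb (Real.log_pos one_lt_two))
  have htwo : (2 : ℝ) ≤ 2 ^ N := le_self_pow₀ one_le_two hN.ne'
  have hsq : (2 : ℝ) ^ (2 * N) = 2 ^ N * 2 ^ N := by rw [two_mul, pow_add]
  refine isUniformlyPerfect_of_forall_not_ringSeparates isClosed_frontier.isCompact hcard
    (c := (2 ^ (2 * N))⁻¹) (by positivity) ?_ fun a r hr hsep => ?_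
  · rw [one_div]
    exact inv_anti₀ two_pos (by nlinarith)
  obtain ⟨s, rfl⟩ : ∃ s, r = 2 ^ (2 * N) * s :=
    ⟨(2 ^ (2 * N))⁻¹ * r, (mul_inv_cancel_left₀ (by positivity) r).symm⟩
  have hs : 0 < s := pos_of_mul_pos_right hr (by positivity)
  rw [inv_mul_cancel_left₀ (by positivity)] at hsep
  have hinner : s ≤ 2 ^ N * s := le_mul_of_one_le_left hs.le (one_le_pow₀ one_le_two)
  have houter : 2 ^ N * s ≤ 2 ^ (2 * N) * s := by rw [hsq]; nlinarith
  have : Nontrivial (Rn n) := Module.nontrivial_of_finrank_pos (R := ℝ)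
    (by rw [finrank_euclideanSpace_fin]; omega)
  obtain ⟨u, hu⟩ := exists_norm_eq (Rn n) (hs.le.trans hinner)
  have hsphere : ∀ z : Rn n, dist z a = 2 ^ N * s → (z : MobiusSpace n) ∈ G := fun z hz =>
    hsep.mem_domain hn hG hs (hinner.trans houter) (hz ▸ ⟨hinner, houter⟩)
  have hx : dist (a + u) a = 2 ^ N * s := by rw [dist_self_add_left, hu]
  have hy : dist (a - u) a = 2 ^ N * s := by rw [dist_self_sub_left, hu]
  have hδ : Real.log 2 ≤ mobiusMetric G (a + u : Rn n) (a - u : Rn n) :=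
    log_two_le_mobiusMetric hG.1 (norm_pos_iff.1 (hu ▸ by positivity))
      (hu ▸ hsep.mono_right houter) (hsphere _ hx) (hsphere _ hy)
  refine hlt.not_ge ?_
  calc ENNReal.ofReal (b * Real.log 2)
      ≤ ENNReal.ofReal (b * mobiusMetric G (a + u : Rn n) (a - u : Rn n)) := by gcongr
    _ ≤ modulusMetric G (a + u : Rn n) (a - u : Rn n) := hle _ (hsphere _ hx) _ (hsphere _ hy)
    _ ≤ _ := modulusMetric_le_of_ringSeparates hn hG hN hs hsep hx hy

end Converse

/-! ### Measures on thick sets -/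

section Frostman

open Filter Topology

/-- The fair coin-tossing measure on infinite binary sequences. -/
def coinMeasure : Measure (ℕ → Bool) :=
  Measure.infinitePi fun _ : ℕ => (PMF.uniformOfFintype Bool).toMeasure

instance : IsProbabilityMeasure coinMeasure := by
  unfold coinMeasure; infer_instance

lemma coinMeasure_le_of_forall_eq {k : ℕ} {S : Set (ℕ → Bool)}
    (hS : ∀ ω ∈ S, ∀ ω' ∈ S, ∀ i < k, ω i = ω' i) : coinMeasure S ≤ 2⁻¹ ^ k := by
  rcases S.eq_empty_or_nonempty with rfl | ⟨ω, hω⟩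
  · simp
  have hsub : S ⊆ Set.pi (Finset.range k : Set ℕ) fun i => {ω i} := fun ω' hω' i hi =>
    hS ω' hω' ω hω i (by simpa using hi)
  refine (measure_mono hsub).trans ?_
  rw [coinMeasure, Measure.infinitePi_pi _ fun _ _ => measurableSet_singleton _]
  simp

variable {X : Type*} [PseudoMetricSpace X]

/-- A dyadic tree of points: `T k ω` depends only on the first `k` digits of `ω`, the steps decay
like `q ^ k`, and the two children of a point on level `k` are separated on the scale
`q ^ (k + 1)`. -/
structure IsSeparatedTree (T : ℕ → (ℕ → Bool) → X) (q r : ℝ) : Prop where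
  congr : ∀ {k ω ω'}, (∀ i < k, ω i = ω' i) → T k ω = T k ω'
  dist_succ_le : ∀ k ω, dist (T (k + 1) ω) (T k ω) ≤ q ^ k * r / 2
  le_dist : ∀ {k ω ω'}, (∀ i < k, ω i = ω' i) → ω k ≠ ω' k →
    4 * (q ^ (k + 1) * r) ≤ dist (T (k + 1) ω) (T (k + 1) ω')

namespace IsSeparatedTree

variable {T : ℕ → (ℕ → Bool) → X} {q r : ℝ}

lemma continuous (hT : IsSeparatedTree T q r) (k : ℕ) : Continuous (T k) := by
  refine ((IsLocallyConstant.iff_eventually_eq _).2 fun ω => ?_).continuous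
  have hagree : ∀ᶠ ω' in 𝓝 ω, ∀ i ∈ Finset.range k, ω' i = ω i :=
    (Filter.eventually_all_finset _).2 fun i _ =>
      (continuous_apply i).continuousAt.eventually_mem (isOpen_discrete {ω i} |>.mem_nhds rfl)
  filter_upwards [hagree] with ω' h
  exact hT.congr fun i hi => h i (Finset.mem_range.2 hi)

lemma dist_add_le (hT : IsSeparatedTree T q r) (hq : 0 < q) (hq2 : q ≤ 1 / 2) (hr : 0 < r)
    (k m : ℕ) (ω : ℕ → Bool) :
    dist (T (k + m) ω) (T k ω) + q ^ (k + m) * r ≤ q ^ k * r := by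
  induction m with
  | zero => simp
  | succ m ih =>
    have htri := dist_triangle (T (k + m + 1) ω) (T (k + m) ω) (T k ω)
    have hpos : 0 < q ^ (k + m) * r := by positivity
    have hhalf : q ^ (k + m + 1) * r ≤ q ^ (k + m) * r / 2 := by rw [pow_succ]; nlinarith
    rw [← add_assoc]
    linarith [hT.dist_succ_le (k + m) ω]

lemma exists_limit [CompleteSpace X] (hT : IsSeparatedTree T q r) (hq : 0 < q) (hq2 : q ≤ 1 / 2)
    (hr : 0 < r) (ω : ℕ → Bool) :
    ∃ p, Tendsto (fun k => T k ω) atTop (𝓝 p) ∧ ∀ k, dist p (T k ω) ≤ q ^ k * r := by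
  obtain ⟨p, hp⟩ := cauchySeq_tendsto_of_complete
    (cauchySeq_of_le_geometric (f := fun k => T k ω) q (r / 2) (by linarith) fun k => by
      rw [dist_comm]
      linarith [hT.dist_succ_le k ω])
  refine ⟨p, hp, fun k => le_of_tendsto (hp.dist tendsto_const_nhds) ?_⟩
  filter_upwards [eventually_ge_atTop k] with m hm
  obtain ⟨j, rfl⟩ := Nat.exists_eq_add_of_le hm
  have hpos : 0 < q ^ (k + j) * r := by positivity
  linarith [hT.dist_add_le hq hq2 hr k j ω]

lemma agree_of_dist_lt (hT : IsSeparatedTree T q r) (hq : 0 < q) (hq2 : q ≤ 1 / 2)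
    (hr : 0 < r) {Φ : (ℕ → Bool) → X} (hΦ : ∀ ω k, dist (Φ ω) (T k ω) ≤ q ^ k * r) {k : ℕ}
    {ω ω' : ℕ → Bool} (hlt : dist (Φ ω) (Φ ω') < 2 * (q ^ k * r)) : ∀ i < k, ω i = ω' i := by
  intro i
  induction i using Nat.strong_induction_on with
  | _ i ih =>
    intro hi
    by_contra hne
    have hsep := hT.le_dist (fun j hj => ih j hj (hj.trans hi)) hne
    have htri := dist_triangle4 (T (i + 1) ω) (Φ ω) (Φ ω') (T (i + 1) ω')
    rw [dist_comm _ (Φ ω)] at htri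
    have hle : q ^ k * r ≤ q ^ (i + 1) * r :=
      mul_le_mul_of_nonneg_right (pow_le_pow_of_le_one hq.le (by linarith) hi) hr.le
    linarith [hΦ ω (i + 1), hΦ ω' (i + 1)]

lemma exists_measure [CompleteSpace X] [MeasurableSpace X] [BorelSpace X]
    (hT : IsSeparatedTree T q r) (hq : 0 < q) (hq2 : q ≤ 1 / 2) (hr : 0 < r) {F : Set X}
    (hF : IsClosed F) (hTF : ∀ k ω, T k ω ∈ F) :
    ∃ ν : Measure X, IsProbabilityMeasure ν ∧ (∀ᵐ p ∂ν, p ∈ F) ∧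
      ∀ z k, ν (Metric.ball z (q ^ k * r)) ≤ 2⁻¹ ^ k := by
  choose Φ hΦ hdist using hT.exists_limit hq hq2 hr
  have hmeas : Measurable Φ := measurable_of_tendsto_metrizable
    (fun k => (hT.continuous k).measurable) (tendsto_pi_nhds.2 hΦ)
  refine ⟨coinMeasure.map Φ, Measure.isProbabilityMeasure_map hmeas.aemeasurable,
    (ae_map_iff hmeas.aemeasurable hF.measurableSet).2 (Eventually.of_forall fun ω =>
      hF.mem_of_tendsto (hΦ ω) (Eventually.of_forall fun k => hTF k ω)), fun z k => ?_⟩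
  rw [Measure.map_apply hmeas Metric.isOpen_ball.measurableSet]
  refine coinMeasure_le_of_forall_eq fun ω hω ω' hω' => hT.agree_of_dist_lt hq hq2 hr hdist ?_
  have hω : dist (Φ ω) z < q ^ k * r := hω
  have hω' : dist (Φ ω') z < q ^ k * r := hω'
  linarith [dist_triangle_right (Φ ω) (Φ ω') z]

end IsSeparatedTree

/-- Near the point `a₀` and up to the scale `r`, the set `F` meets all rings of ratio `c` centered
at points of `F`: a local form of uniform perfectness. -/
def IsThickAt (F : Set X) (c r : ℝ) (a₀ : X) : Prop :=
  a₀ ∈ F ∧ ∀ a ∈ F, dist a a₀ ≤ r → ∀ s, 0 < s → s ≤ r →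
    ∃ y ∈ F, c * s ≤ dist y a ∧ dist y a ≤ s

/-- The points of a binary tree in which the second child of the point `a` on level `k` is
`sib k a` and the first one is `a` itself. -/
def treePoint {X : Type*} (sib : ℕ → X → X) (a₀ : X) : ℕ → (ℕ → Bool) → X
  | 0, _ => a₀
  | k + 1, ω => if ω k then sib k (treePoint sib a₀ k ω) else treePoint sib a₀ k ω

lemma treePoint_congr {X : Type*} (sib : ℕ → X → X) (a₀ : X) {ω ω' : ℕ → Bool} {k : ℕ}
    (h : ∀ i < k, ω i = ω' i) : treePoint sib a₀ k ω = treePoint sib a₀ k ω' := by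
  induction k with
  | zero => rfl
  | succ k ih =>
    rw [treePoint, treePoint, h k (Nat.lt_succ_self k), ih fun i hi => h i (by omega)]

lemma dist_treePoint_succ {sib : ℕ → X → X} {a₀ : X} {k : ℕ} {ω ω' : ℕ → Bool}
    (h : ∀ i < k, ω i = ω' i) (hne : ω k ≠ ω' k) :
    dist (treePoint sib a₀ (k + 1) ω) (treePoint sib a₀ (k + 1) ω') =
      dist (sib k (treePoint sib a₀ k ω)) (treePoint sib a₀ k ω) := by
  rw [treePoint, treePoint, ← treePoint_congr sib a₀ h]
  cases hω : ω k <;> cases hω' : ω' k <;> simp_all [dist_comm]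

lemma isSeparatedTree_treePoint {sib : ℕ → X → X} {a₀ : X} {q r : ℝ} (hq : 0 ≤ q) (hr : 0 ≤ r)
    (hsib : ∀ k ω, 4 * (q ^ (k + 1) * r) ≤
        dist (sib k (treePoint sib a₀ k ω)) (treePoint sib a₀ k ω) ∧
      dist (sib k (treePoint sib a₀ k ω)) (treePoint sib a₀ k ω) ≤ q ^ k * r / 2) :
    IsSeparatedTree (treePoint sib a₀) q r where
  congr := treePoint_congr sib a₀
  dist_succ_le k ω := by
    rw [treePoint]
    split_ifs
    · exact (hsib k ω).2
    · rw [dist_self]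
      positivity
  le_dist h hne := by
    rw [dist_treePoint_succ h hne]
    exact (hsib _ _).1

lemma IsThickAt.exists_sibling {F : Set X} {c r : ℝ} {a₀ : X} (h : IsThickAt F c r a₀) {s : ℝ}
    (hs : 0 < s) (hsr : s ≤ r) (a : X) :
    ∃ a', a ∈ F → dist a a₀ ≤ r → a' ∈ F ∧ c * s ≤ dist a' a ∧ dist a' a ≤ s := by
  by_cases ha : a ∈ F ∧ dist a a₀ ≤ r
  · obtain ⟨a', hmem, hdist⟩ := h.2 a ha.1 ha.2 s hs hsr
    exact ⟨a', fun _ _ => ⟨hmem, hdist⟩⟩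
  · exact ⟨a, fun haF had => absurd ⟨haF, had⟩ ha⟩

lemma treePoint_mem_of_sibling {F : Set X} {sib : ℕ → X → X} {a₀ : X} {q r : ℝ} (hq : 0 < q)
    (hq2 : q ≤ 1 / 2) (hr : 0 < r) (ha₀ : a₀ ∈ F)
    (hsib : ∀ k, ∀ a ∈ F, dist a a₀ ≤ r → sib k a ∈ F ∧ dist (sib k a) a ≤ q ^ k * r / 2)
    (k : ℕ) (ω : ℕ → Bool) :
    treePoint sib a₀ k ω ∈ F ∧ dist (treePoint sib a₀ k ω) a₀ + q ^ k * r ≤ r := by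
  induction k with
  | zero => simpa [treePoint] using ha₀
  | succ k ih =>
    have hpos : 0 < q ^ k * r := by positivity
    have hhalf : q ^ (k + 1) * r ≤ q ^ k * r / 2 := by rw [pow_succ]; nlinarith
    rw [treePoint]
    split_ifs
    · obtain ⟨hmem, hdist⟩ := hsib k _ ih.1 (by linarith)
      have htri := dist_triangle (sib k (treePoint sib a₀ k ω)) (treePoint sib a₀ k ω) a₀
      exact ⟨hmem, by linarith⟩
    · exact ⟨ih.1, by linarith⟩

lemma IsThickAt.exists_isSeparatedTree {F : Set X} {c r : ℝ} {a₀ : X} (hc : 0 < c) (hc1 : c ≤ 1)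
    (hr : 0 < r) (h : IsThickAt F c r a₀) :
    ∃ T, IsSeparatedTree T (c / 8) r ∧ ∀ k ω, T k ω ∈ F ∩ Metric.closedBall a₀ r := by
  have hq : 0 < c / 8 := by positivity
  have hscale : ∀ k : ℕ, (c / 8) ^ k * r / 2 ≤ r := fun k => by
    linarith [mul_le_of_le_one_left hr.le (pow_le_one₀ (n := k) hq.le (by linarith))]
  choose sib hsib using fun (k : ℕ) (a : X) =>
    h.exists_sibling (s := (c / 8) ^ k * r / 2) (by positivity) (hscale k) a
  have hmem : ∀ k ω, treePoint sib a₀ k ω ∈ F ∧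
      dist (treePoint sib a₀ k ω) a₀ + (c / 8) ^ k * r ≤ r :=
    treePoint_mem_of_sibling hq (by linarith) hr h.1 fun k a ha had =>
      ⟨(hsib k a ha had).1, (hsib k a ha had).2.2⟩
  have hball : ∀ k ω, dist (treePoint sib a₀ k ω) a₀ ≤ r := fun k ω => by
    have : 0 < (c / 8) ^ k * r := by positivity
    linarith [(hmem k ω).2]
  refine ⟨treePoint sib a₀, isSeparatedTree_treePoint hq.le hr.le fun k ω => ?_,
    fun k ω => ⟨(hmem k ω).1, hball k ω⟩⟩
  obtain ⟨-, hlow, hup⟩ := hsib k _ (hmem k ω).1 (hball k ω)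
  exact ⟨le_of_eq_of_le (by ring) hlow, hup⟩

theorem IsThickAt.exists_measure [CompleteSpace X] [MeasurableSpace X] [BorelSpace X] {F : Set X}
    (hF : IsClosed F) {c r : ℝ} {a₀ : X} (hc : 0 < c) (hc1 : c ≤ 1) (hr : 0 < r)
    (h : IsThickAt F c r a₀) :
    ∃ ν : Measure X, IsProbabilityMeasure ν ∧ (∀ᵐ p ∂ν, p ∈ F ∧ dist p a₀ ≤ r) ∧
      ∀ z k, ν (Metric.ball z ((c / 8) ^ k * r)) ≤ 2⁻¹ ^ k := by
  obtain ⟨T, hT, hmem⟩ := h.exists_isSeparatedTree hc hc1 hr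
  exact hT.exists_measure (by positivity) (by linarith) hr
    (hF.inter Metric.isClosed_closedBall) hmem

lemma exists_pow_mul_le_and_lt {q r d : ℝ} (hq1 : q < 1) (hd : 0 < d) (hdr : d < r) :
    ∃ k : ℕ, q ^ (k + 1) * r ≤ d ∧ d < q ^ k * r := by
  have hr : 0 < r := hd.trans hdr
  have hex : ∃ m : ℕ, q ^ m * r ≤ d := by
    obtain ⟨m, hm⟩ := exists_pow_lt_of_lt_one (div_pos hd hr) hq1
    exact ⟨m, ((lt_div_iff₀ hr).1 hm).le⟩
  have hspec := Nat.find_spec hex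
  cases hk : Nat.find hex with
  | zero =>
    rw [hk, pow_zero, one_mul] at hspec
    exact absurd hdr hspec.not_gt
  | succ k => exact ⟨k, hk ▸ hspec, not_le.1 (Nat.find_min hex (by omega))⟩

variable {q r β : ℝ}

lemma ae_dist_pos_of_measure_ball_le [MeasurableSpace X] {ν : Measure X} (hq : 0 < q) (hr : 0 < r)
    (hν : ∀ z k, ν (Metric.ball z (q ^ k * r)) ≤ 2⁻¹ ^ k) (z : X) : ∀ᵐ p ∂ν, 0 < dist z p := by
  have hlim := ENNReal.tendsto_pow_atTop_nhds_zero_of_lt_one (r := 2⁻¹) (by simp)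
  have hnull : ν {p | dist z p ≤ 0} ≤ 0 := by
    refine ge_of_tendsto' hlim fun k => (measure_mono ?_).trans (hν z k)
    intro p (hp : dist z p ≤ 0)
    rw [Metric.mem_ball, dist_comm]
    exact hp.trans_lt (by positivity)
  simpa only [ae_iff, not_lt] using nonpos_iff_eq_zero.1 hnull

lemma inv_ofReal_pow_mul_rpow (hq : 0 < q) (hr : 0 < r) (hβ : 0 ≤ β) (k : ℕ) :
    (ENNReal.ofReal (q ^ k * r) ^ β)⁻¹ =
      ((ENNReal.ofReal q ^ β)⁻¹) ^ k * (ENNReal.ofReal r ^ β)⁻¹ := by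
  rw [ENNReal.ofReal_mul (by positivity), ENNReal.ofReal_pow hq.le,
    ENNReal.mul_rpow_of_nonneg _ _ hβ, ← ENNReal.inv_pow, ← ENNReal.rpow_natCast,
    ← ENNReal.rpow_natCast, ← ENNReal.rpow_mul, ← ENNReal.rpow_mul, mul_comm β, ENNReal.mul_inv]
  · exact .inr (ENNReal.rpow_ne_top_of_nonneg hβ ENNReal.ofReal_ne_top)
  · exact .inr (ENNReal.rpow_pos (ENNReal.ofReal_pos.2 hr) ENNReal.ofReal_ne_top).ne'

lemma inv_dist_rpow_le_tsum_indicator (hq : 0 < q) (hq1 : q < 1) (hr : 0 < r) (hβ : 0 ≤ β)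
    {z p : X} (hp : 0 < dist z p) :
    (ENNReal.ofReal (dist z p) ^ β)⁻¹ ≤ (ENNReal.ofReal r ^ β)⁻¹ +
      ∑' k : ℕ, (Metric.ball z (q ^ k * r)).indicator
        (fun _ => ((ENNReal.ofReal q ^ β)⁻¹) ^ (k + 1) * (ENNReal.ofReal r ^ β)⁻¹) p := by
  rcases le_or_gt r (dist z p) with hle | hlt
  · exact le_add_right (by gcongr)
  · obtain ⟨k, hk, hk'⟩ := exists_pow_mul_le_and_lt hq1 hp hlt
    refine le_add_left (le_trans ?_ (ENNReal.le_tsum k))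
    rw [indicator_of_mem (by rwa [Metric.mem_ball, dist_comm]), ← inv_ofReal_pow_mul_rpow hq hr hβ]
    gcongr

lemma lintegral_inv_dist_rpow_le [MeasurableSpace X] [OpensMeasurableSpace X] {ν : Measure X}
    [IsProbabilityMeasure ν] (hq : 0 < q) (hq1 : q < 1) (hr : 0 < r) (hβ : 0 ≤ β)
    (hν : ∀ z k, ν (Metric.ball z (q ^ k * r)) ≤ 2⁻¹ ^ k) (z : X) :
    ∫⁻ p, (ENNReal.ofReal (dist z p) ^ β)⁻¹ ∂ν ≤
      (1 + ∑' k : ℕ, 2⁻¹ ^ k * ((ENNReal.ofReal q ^ β)⁻¹) ^ (k + 1)) *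
        (ENNReal.ofReal r ^ β)⁻¹ := by
  refine (lintegral_mono_ae ((ae_dist_pos_of_measure_ball_le hq hr hν z).mono fun p hp =>
    inv_dist_rpow_le_tsum_indicator hq hq1 hr hβ hp)).trans ?_
  rw [lintegral_add_left measurable_const, lintegral_const, measure_univ, mul_one,
    lintegral_tsum fun k => (measurable_const.indicator
      Metric.isOpen_ball.measurableSet).aemeasurable, add_mul, one_mul, ← ENNReal.tsum_mul_right]
  gcongr with k
  rw [lintegral_indicator Metric.isOpen_ball.measurableSet, setLIntegral_const, mul_comm,
    ← mul_assoc]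
  gcongr
  exact hν z k

lemma one_add_tsum_ne_top {Q : ℝ≥0∞} (hQ : Q < 2) :
    1 + ∑' k : ℕ, 2⁻¹ ^ k * Q ^ (k + 1) ≠ ⊤ := by
  have hhalf : 2⁻¹ * Q < 1 := by
    rw [mul_comm, ← div_eq_mul_inv]
    exact ENNReal.div_lt_of_lt_mul (by simpa using hQ)
  have hterm : ∀ k : ℕ, (2⁻¹ : ℝ≥0∞) ^ k * Q ^ (k + 1) = Q * (2⁻¹ * Q) ^ k := fun k => by
    rw [mul_pow, pow_succ]; ring
  simp_rw [hterm, ENNReal.tsum_mul_left, ENNReal.tsum_geometric]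
  exact ENNReal.add_ne_top.2 ⟨ENNReal.one_ne_top,
    ENNReal.mul_ne_top hQ.ne_top (ENNReal.inv_ne_top.2 (tsub_pos_of_lt hhalf).ne')⟩

end Frostman

/-! ### Averages of line integrals over random segments -/

section Segments

variable {n : ℕ}

/-- The line integral of `ρ` over the segment from `p` to `w`. -/
def segmentIntegral (ρ : Rn n → ℝ≥0∞) (p w : Rn n) : ℝ≥0∞ :=
  ENNReal.ofReal (dist p w) * ∫⁻ t in Ioo (0 : ℝ) 1, ρ (p + t • (w - p))

lemma measurable_segmentIntegral {ρ : Rn n → ℝ≥0∞} (hρ : Measurable ρ) (p : Rn n) :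
    Measurable (segmentIntegral ρ p) := by
  refine Measurable.mul (by fun_prop) ?_
  exact Measurable.lintegral_prod_right'
    (f := fun x : Rn n × ℝ => ρ (p + x.2 • (x.1 - p))) (hρ.comp (by fun_prop))

lemma inv_ofReal_div_rpow {d ℓ β : ℝ} (hℓ : 0 < ℓ) (hβ : 0 ≤ β) :
    (ENNReal.ofReal (d / ℓ) ^ β)⁻¹ = ENNReal.ofReal ℓ ^ β * (ENNReal.ofReal d ^ β)⁻¹ := by
  rw [ENNReal.ofReal_div_of_pos hℓ, ENNReal.div_rpow_of_nonneg _ _ hβ, ENNReal.inv_div,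
    div_eq_mul_inv]
  · exact .inl (ENNReal.rpow_ne_top_of_nonneg hβ ENNReal.ofReal_ne_top)
  · exact .inl (ENNReal.rpow_pos (ENNReal.ofReal_pos.2 hℓ) ENNReal.ofReal_ne_top).ne'

lemma setLIntegral_Ici_rpow_le {u β : ℝ} (hβ : 0 < β) :
    ∫⁻ t in Ici u, ENNReal.ofReal (t ^ (-1 - β)) ≤
      ENNReal.ofReal β⁻¹ * (ENNReal.ofReal u ^ β)⁻¹ := by
  rcases le_or_gt u 0 with hu | hu
  · rw [ENNReal.ofReal_of_nonpos hu, ENNReal.zero_rpow_of_pos hβ, ENNReal.inv_zero,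
      ENNReal.mul_top (ENNReal.ofReal_pos.2 (inv_pos.2 hβ)).ne']
    exact le_top
  have hint := integrableOn_Ioi_rpow_of_lt (a := -1 - β) (by linarith) hu
  have hnonneg : ∀ᵐ t ∂volume.restrict (Ioi u), 0 ≤ t ^ (-1 - β) := by
    filter_upwards [ae_restrict_mem measurableSet_Ioi] with t ht
    exact Real.rpow_nonneg (hu.trans ht).le _
  refine le_of_eq ?_
  rw [setLIntegral_congr Ioi_ae_eq_Ici.symm, ← ofReal_integral_eq_lintegral_ofReal hint hnonneg,
    integral_Ioi_rpow_of_lt (by linarith) hu, ENNReal.ofReal_rpow_of_pos hu,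
    ← ENNReal.ofReal_inv_of_pos (by positivity), ← ENNReal.ofReal_mul (by positivity),
    show -1 - β + 1 = -β by ring, neg_div_neg_eq, Real.rpow_neg hu.le, div_eq_inv_mul]

lemma lintegral_comp_homothety {f : Rn n → ℝ≥0∞} (hf : Measurable f) (p : Rn n) {t : ℝ}
    (ht : 0 < t) :
    ∫⁻ w, f (p + t • (w - p)) = ENNReal.ofReal ((t ^ n)⁻¹) * ∫⁻ z, f z := by
  calc ∫⁻ w, f (p + t • (w - p)) = ∫⁻ w, f (p + t • w) :=
        lintegral_sub_right_eq_self (fun w => f (p + t • w)) p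
    _ = ∫⁻ z, f (p + z) ∂(Measure.map (t • ·) volume) :=
        (lintegral_map (hf.comp (measurable_const_add p)) (measurable_const_smul t)).symm
    _ = ENNReal.ofReal ((t ^ n)⁻¹) * ∫⁻ z, f (p + z) := by
        rw [Measure.map_addHaar_smul _ ht.ne', lintegral_smul_measure, finrank_euclideanSpace_fin,
          abs_of_pos (by positivity), smul_eq_mul]
    _ = _ := by rw [lintegral_add_left_eq_self f p]

lemma setLIntegral_comp_homothety_le {f : Rn n → ℝ≥0∞} (hf : Measurable f) (p : Rn n) {t ℓ : ℝ}
    (ht : 0 < t) {B : Set (Rn n)} (hB : MeasurableSet B) (hBℓ : ∀ w ∈ B, dist p w ≤ ℓ) :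
    ∫⁻ w in B, f (p + t • (w - p)) ≤
      ENNReal.ofReal ((t ^ n)⁻¹) * ∫⁻ z, (Metric.closedBall p (t * ℓ)).indicator f z := by
  rw [← lintegral_comp_homothety (hf.indicator Metric.isClosed_closedBall.measurableSet) p ht]
  refine le_trans (le_of_eq ?_) (setLIntegral_le_lintegral B _)
  refine setLIntegral_congr_fun hB fun w hw => ?_
  rw [indicator_of_mem]
  rw [Metric.mem_closedBall, dist_eq_norm, add_sub_cancel_left, norm_smul,
    Real.norm_of_nonneg ht.le, ← dist_eq_norm, dist_comm]
  exact mul_le_mul_of_nonneg_left (hBℓ w hw) ht.le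

lemma rpow_mul_setLIntegral_comp_homothety_le {f : Rn n → ℝ≥0∞} (hf : Measurable f) (p : Rn n)
    {t ℓ : ℝ} (ht : 0 < t) (hℓ : 0 < ℓ) (β : ℝ) {B : Set (Rn n)} (hB : MeasurableSet B)
    (hBℓ : ∀ w ∈ B, dist p w ≤ ℓ) :
    ENNReal.ofReal (t ^ ((n : ℝ) - 1 - β)) * ∫⁻ w in B, f (p + t • (w - p)) ≤
      ∫⁻ z, f z * (Ici (dist z p / ℓ)).indicator (fun t => ENNReal.ofReal (t ^ (-1 - β))) t := by
  have hpow : ENNReal.ofReal (t ^ ((n : ℝ) - 1 - β)) * ENNReal.ofReal ((t ^ n)⁻¹) =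
      ENNReal.ofReal (t ^ (-1 - β)) := by
    rw [← ENNReal.ofReal_mul (by positivity), ← Real.rpow_natCast, ← Real.rpow_neg ht.le,
      ← Real.rpow_add ht]
    ring_nf
  calc _ ≤ ENNReal.ofReal (t ^ ((n : ℝ) - 1 - β)) * (ENNReal.ofReal ((t ^ n)⁻¹) *
        ∫⁻ z, (Metric.closedBall p (t * ℓ)).indicator f z) := by
        gcongr
        exact setLIntegral_comp_homothety_le hf p ht hB hBℓ
    _ = _ := by
        rw [← mul_assoc, hpow, ← lintegral_const_mul' _ _ ENNReal.ofReal_ne_top]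
        refine lintegral_congr fun z => ?_
        simp only [indicator, Metric.mem_closedBall, mem_Ici, div_le_iff₀ hℓ, mul_ite, mul_zero,
          mul_comm (ENNReal.ofReal _), ite_mul, zero_mul]

lemma measurable_mul_indicator_Ici_dist {f : Rn n → ℝ≥0∞} (hf : Measurable f) (p : Rn n)
    (ℓ s : ℝ) :
    Measurable fun q : ℝ × Rn n =>
      f q.2 * (Ici (dist q.2 p / ℓ)).indicator (fun t => ENNReal.ofReal (t ^ s)) q.1 := by
  refine (hf.comp measurable_snd).mul ?_
  have hset : MeasurableSet {q : ℝ × Rn n | dist q.2 p / ℓ ≤ q.1} :=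
    measurableSet_le (by fun_prop) (by fun_prop)
  exact Measurable.indicator (f := fun q : ℝ × Rn n => ENNReal.ofReal (q.1 ^ s)) (by fun_prop) hset

lemma lintegral_weighted_cone_le {f : Rn n → ℝ≥0∞} (hf : Measurable f) (p : Rn n) {ℓ β : ℝ}
    (hℓ : 0 < ℓ) (hβ : 0 < β) {B : Set (Rn n)} (hB : MeasurableSet B)
    (hBℓ : ∀ w ∈ B, dist p w ≤ ℓ) :
    ∫⁻ t in Ioo (0 : ℝ) 1, ENNReal.ofReal (t ^ ((n : ℝ) - 1 - β)) *
        ∫⁻ w in B, f (p + t • (w - p)) ≤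
      ENNReal.ofReal β⁻¹ * ENNReal.ofReal ℓ ^ β *
        ∫⁻ z, f z * (ENNReal.ofReal (dist z p) ^ β)⁻¹ := by
  have hconst : ENNReal.ofReal β⁻¹ * ENNReal.ofReal ℓ ^ β ≠ ⊤ := ENNReal.mul_ne_top
    ENNReal.ofReal_ne_top (ENNReal.rpow_ne_top_of_nonneg hβ.le ENNReal.ofReal_ne_top)
  calc _ ≤ ∫⁻ t in Ioo (0 : ℝ) 1, ∫⁻ z, f z *
        (Ici (dist z p / ℓ)).indicator (fun t => ENNReal.ofReal (t ^ (-1 - β))) t :=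
        setLIntegral_mono' measurableSet_Ioo fun t ht =>
          rpow_mul_setLIntegral_comp_homothety_le hf p ht.1 hℓ β hB hBℓ
    _ = ∫⁻ z, ∫⁻ t in Ioo (0 : ℝ) 1, f z *
        (Ici (dist z p / ℓ)).indicator (fun t => ENNReal.ofReal (t ^ (-1 - β))) t :=
        lintegral_lintegral_swap (measurable_mul_indicator_Ici_dist hf p ℓ _).aemeasurable
    _ ≤ ∫⁻ z, f z * ∫⁻ t in Ici (dist z p / ℓ), ENNReal.ofReal (t ^ (-1 - β)) := by
        refine lintegral_mono fun z => ?_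
        rw [lintegral_const_mul _ (Measurable.indicator (by fun_prop) measurableSet_Ici),
          ← lintegral_indicator measurableSet_Ici]
        gcongr
        exact Measure.restrict_le_self
    _ ≤ ∫⁻ z, ENNReal.ofReal β⁻¹ * ENNReal.ofReal ℓ ^ β *
        (f z * (ENNReal.ofReal (dist z p) ^ β)⁻¹) := by
        refine lintegral_mono fun z => ?_
        calc _ ≤ f z * (ENNReal.ofReal β⁻¹ * (ENNReal.ofReal (dist z p / ℓ) ^ β)⁻¹) := by
              gcongr
              exact setLIntegral_Ici_rpow_le hβ
          _ = _ := by
              rw [inv_ofReal_div_rpow hℓ hβ.le]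
              ring
    _ = _ := lintegral_const_mul' _ _ hconst

lemma pow_lintegral_le_weighted {α : Type*} [MeasurableSpace α] {μ : Measure α} (hn : 2 ≤ n)
    {g w : α → ℝ≥0∞} (hg : AEMeasurable g μ) (hw : AEMeasurable w μ) (hw0 : ∀ᵐ x ∂μ, w x ≠ 0)
    (hwt : ∀ᵐ x ∂μ, w x ≠ ⊤) :
    (∫⁻ x, g x ∂μ) ^ n ≤ (∫⁻ x, g x ^ n * w x ∂μ) *
      (∫⁻ x, (w x)⁻¹ ^ (1 / ((n : ℝ) - 1)) ∂μ) ^ (n - 1) := by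
  have hn1 : (1 : ℝ) < n := by exact_mod_cast hn
  have hn0 : (n : ℝ) - 1 ≠ 0 := by linarith
  have hpq := Real.HolderConjugate.conjExponent hn1
  have hroot : AEMeasurable (fun x => w x ^ (n : ℝ)⁻¹) μ := hw.pow_const _
  have hsplit : ∫⁻ x, g x ∂μ =
      ∫⁻ x, ((fun x => g x * w x ^ (n : ℝ)⁻¹) * fun x => (w x ^ (n : ℝ)⁻¹)⁻¹) x ∂μ := by
    refine lintegral_congr_ae ?_
    filter_upwards [hw0, hwt] with x h0 ht
    rw [Pi.mul_apply, mul_assoc, ENNReal.mul_inv_cancel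
      (ENNReal.rpow_pos (pos_iff_ne_zero.2 h0) ht).ne'
      (ENNReal.rpow_ne_top_of_nonneg (by positivity) ht), mul_one]
  have hholder := ENNReal.lintegral_mul_le_Lp_mul_Lq μ hpq (hg.mul hroot) hroot.inv
  rw [hsplit]
  refine (pow_le_pow_left' hholder n).trans (le_of_eq ?_)
  rw [mul_pow, ← ENNReal.rpow_natCast, ← ENNReal.rpow_mul, ← ENNReal.rpow_natCast,
    ← ENNReal.rpow_mul, ← ENNReal.rpow_natCast, one_div_mul_cancel (by positivity),
    ENNReal.rpow_one, Nat.cast_sub (by omega), Nat.cast_one, Real.conjExponent]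
  congr 1
  · refine lintegral_congr fun x => ?_
    rw [Pi.mul_apply, ENNReal.mul_rpow_of_nonneg _ _ (by positivity), ENNReal.rpow_natCast,
      ← ENNReal.rpow_mul, inv_mul_cancel₀ (by positivity), ENNReal.rpow_one]
  · congr 1
    · refine lintegral_congr fun x => ?_
      rw [Pi.inv_apply, ← ENNReal.inv_rpow, ← ENNReal.rpow_mul]
      congr 1
      field_simp
    · field_simp

/-- The `t`-integral that remains when the weight `t ^ (n - 1 - β)` is split off along a segment by
Hölder's inequality with exponents `n` and `n / (n - 1)`. -/
def radialIntegral (n : ℕ) (β : ℝ) : ℝ≥0∞ :=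
  ∫⁻ t in Ioo (0 : ℝ) 1, ENNReal.ofReal (t ^ (β / ((n : ℝ) - 1) - 1))

lemma radialIntegral_ne_top (hn : 2 ≤ n) {β : ℝ} (hβ : 0 < β) : radialIntegral n β ≠ ⊤ := by
  have hn1 : (1 : ℝ) < n := by exact_mod_cast hn
  have hexp : 0 < β / ((n : ℝ) - 1) := div_pos hβ (by linarith)
  exact ((intervalIntegral.integrableOn_Ioo_rpow_iff one_pos).2 (by linarith)).lintegral_lt_top.ne

variable {ρ : Rn n → ℝ≥0∞} {ν : Measure (Rn n)} {ℓ β : ℝ} {B : Set (Rn n)} {K : ℝ≥0∞}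

lemma lintegral_weighted_cone_prod_le [SFinite ν] (hρ : Measurable ρ) (hℓ : 0 < ℓ) (hβ : 0 < β)
    (hB : MeasurableSet B) (hBℓ : ∀ᵐ p ∂ν, ∀ w ∈ B, dist p w ≤ ℓ)
    (hK : ∀ z, ∫⁻ p, (ENNReal.ofReal (dist z p) ^ β)⁻¹ ∂ν ≤ K) :
    ∫⁻ x, ρ (x.1 + x.2.2 • (x.2.1 - x.1)) ^ n * ENNReal.ofReal (x.2.2 ^ ((n : ℝ) - 1 - β))
        ∂ν.prod ((volume.restrict B).prod (volume.restrict (Ioo (0 : ℝ) 1))) ≤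
      ENNReal.ofReal β⁻¹ * ENNReal.ofReal ℓ ^ β * (K * ∫⁻ z, ρ z ^ n) := by
  have hconst : ENNReal.ofReal β⁻¹ * ENNReal.ofReal ℓ ^ β ≠ ⊤ := ENNReal.mul_ne_top
    ENNReal.ofReal_ne_top (ENNReal.rpow_ne_top_of_nonneg hβ.le ENNReal.ofReal_ne_top)
  calc _ = ∫⁻ p, (∫⁻ t in Ioo (0 : ℝ) 1, ENNReal.ofReal (t ^ ((n : ℝ) - 1 - β)) *
        ∫⁻ w in B, ρ (p + t • (w - p)) ^ n) ∂ν := by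
        rw [lintegral_prod _ (by fun_prop)]
        refine lintegral_congr fun p => ?_
        rw [lintegral_prod_symm _ (by fun_prop)]
        refine lintegral_congr fun t => ?_
        dsimp only
        rw [lintegral_mul_const' _ _ ENNReal.ofReal_ne_top, mul_comm]
    _ ≤ ∫⁻ p, ENNReal.ofReal β⁻¹ * ENNReal.ofReal ℓ ^ β *
        (∫⁻ z, ρ z ^ n * (ENNReal.ofReal (dist z p) ^ β)⁻¹) ∂ν :=
        lintegral_mono_ae (hBℓ.mono fun p hp =>
          lintegral_weighted_cone_le (hρ.pow_const n) p hℓ hβ hB hp)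
    _ = ENNReal.ofReal β⁻¹ * ENNReal.ofReal ℓ ^ β *
        ∫⁻ z, ρ z ^ n * ∫⁻ p, (ENNReal.ofReal (dist z p) ^ β)⁻¹ ∂ν := by
        rw [lintegral_const_mul' _ _ hconst, lintegral_lintegral_swap (by fun_prop)]
        congr 1
        exact lintegral_congr fun z => lintegral_const_mul _ (by fun_prop)
    _ ≤ ENNReal.ofReal β⁻¹ * ENNReal.ofReal ℓ ^ β * ∫⁻ z, ρ z ^ n * K := by
        gcongr with z
        exact hK z
    _ = _ := by rw [lintegral_mul_const _ (hρ.pow_const n), mul_comm K]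

lemma lintegral_inv_weight_rpow_prod [IsProbabilityMeasure ν] (hn : 2 ≤ n) :
    ∫⁻ x, (ENNReal.ofReal (x.2.2 ^ ((n : ℝ) - 1 - β)))⁻¹ ^ (1 / ((n : ℝ) - 1))
        ∂ν.prod ((volume.restrict B).prod (volume.restrict (Ioo (0 : ℝ) 1))) =
      radialIntegral n β * volume B := by
  have hn1 : (1 : ℝ) < n := by exact_mod_cast hn
  have hn0 : (n : ℝ) - 1 ≠ 0 := by linarith
  have hinner : ∫⁻ t in Ioo (0 : ℝ) 1,
      (ENNReal.ofReal (t ^ ((n : ℝ) - 1 - β)))⁻¹ ^ (1 / ((n : ℝ) - 1)) = radialIntegral n β := by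
    refine setLIntegral_congr_fun measurableSet_Ioo fun t ht => ?_
    have ht0 : 0 < t := ht.1
    rw [← ENNReal.ofReal_inv_of_pos (by positivity), ENNReal.ofReal_rpow_of_pos (by positivity),
      ← Real.rpow_neg ht0.le, ← Real.rpow_mul ht0.le]
    congr 2
    field_simp
    ring
  rw [lintegral_prod _ (by fun_prop)]
  dsimp only
  rw [lintegral_const, measure_univ, mul_one, lintegral_prod _ (by fun_prop)]
  dsimp only
  rw [lintegral_const, hinner, Measure.restrict_apply_univ]

lemma pow_lintegral_cone_le [IsProbabilityMeasure ν] (hn : 2 ≤ n) (hρ : Measurable ρ) (hℓ : 0 < ℓ)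
    (hβ : 0 < β) (hB : MeasurableSet B) (hBℓ : ∀ᵐ p ∂ν, ∀ w ∈ B, dist p w ≤ ℓ)
    (hK : ∀ z, ∫⁻ p, (ENNReal.ofReal (dist z p) ^ β)⁻¹ ∂ν ≤ K) :
    (∫⁻ p, (∫⁻ w in B, ∫⁻ t in Ioo (0 : ℝ) 1, ρ (p + t • (w - p))) ∂ν) ^ n ≤
      ENNReal.ofReal β⁻¹ * ENNReal.ofReal ℓ ^ β * (K * ∫⁻ z, ρ z ^ n) *
        (radialIntegral n β * volume B) ^ (n - 1) := by
  set M := ν.prod ((volume.restrict B).prod (volume.restrict (Ioo (0 : ℝ) 1)))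
  have hpos : ∀ᵐ x ∂M, 0 < x.2.2 :=
    Measure.quasiMeasurePreserving_snd.ae (Measure.quasiMeasurePreserving_snd.ae
      ((ae_restrict_mem measurableSet_Ioo).mono fun t ht => ht.1))
  have hmeas : Measurable fun x : Rn n × Rn n × ℝ => ρ (x.1 + x.2.2 • (x.2.1 - x.1)) :=
    hρ.comp (by fun_prop)
  have hfubini : ∫⁻ p, (∫⁻ w in B, ∫⁻ t in Ioo (0 : ℝ) 1, ρ (p + t • (w - p))) ∂ν =
      ∫⁻ x, ρ (x.1 + x.2.2 • (x.2.1 - x.1)) ∂M := by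
    rw [lintegral_prod _ hmeas.aemeasurable]
    refine lintegral_congr fun p => ?_
    rw [lintegral_prod _ (by fun_prop)]
  rw [hfubini, ← lintegral_inv_weight_rpow_prod (ν := ν) hn]
  refine (pow_lintegral_le_weighted (w := fun x => ENNReal.ofReal (x.2.2 ^ ((n : ℝ) - 1 - β)))
    hn hmeas.aemeasurable (by fun_prop) (hpos.mono fun x hx =>
      (ENNReal.ofReal_pos.2 (Real.rpow_pos_of_pos hx _)).ne')
    (.of_forall fun x => ENNReal.ofReal_ne_top)).trans ?_
  gcongr
  exact lintegral_weighted_cone_prod_le hρ hℓ hβ hB hBℓ hK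

lemma pow_lintegral_segmentIntegral_le [IsProbabilityMeasure ν] (hn : 2 ≤ n) (hρ : Measurable ρ)
    (hℓ : 0 < ℓ) (hβ : 0 < β) (hB : MeasurableSet B) (hBℓ : ∀ᵐ p ∂ν, ∀ w ∈ B, dist p w ≤ ℓ)
    (hK : ∀ z, ∫⁻ p, (ENNReal.ofReal (dist z p) ^ β)⁻¹ ∂ν ≤ K) :
    (∫⁻ p, (∫⁻ w in B, segmentIntegral ρ p w) ∂ν) ^ n ≤ ENNReal.ofReal ℓ ^ n *
      (ENNReal.ofReal β⁻¹ * ENNReal.ofReal ℓ ^ β * (K * ∫⁻ z, ρ z ^ n) *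
        (radialIntegral n β * volume B) ^ (n - 1)) := by
  calc _ ≤ (∫⁻ p, ENNReal.ofReal ℓ *
        (∫⁻ w in B, ∫⁻ t in Ioo (0 : ℝ) 1, ρ (p + t • (w - p))) ∂ν) ^ n := by
        refine pow_le_pow_left' (lintegral_mono_ae (hBℓ.mono fun p hp => ?_)) n
        rw [← lintegral_const_mul' _ _ ENNReal.ofReal_ne_top]
        refine setLIntegral_mono' hB fun w hw => ?_
        unfold segmentIntegral
        gcongr
        exact hp w hw
    _ = ENNReal.ofReal ℓ ^ n *
        (∫⁻ p, (∫⁻ w in B, ∫⁻ t in Ioo (0 : ℝ) 1, ρ (p + t • (w - p))) ∂ν) ^ n := by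
        rw [lintegral_const_mul' _ _ ENNReal.ofReal_ne_top, mul_pow]
    _ ≤ _ := by
        gcongr
        exact pow_lintegral_cone_le hn hρ hℓ hβ hB hBℓ hK

end Segments

/-! ### The energy estimate for curves joining two thick sets -/

section TwoSets

variable {n : ℕ}

lemma volume_le_lintegral_segmentIntegral_add {ρ : Rn n → ℝ≥0∞} (hρ : Measurable ρ)
    {ν₁ ν₂ : Measure (Rn n)} [IsProbabilityMeasure ν₁] [IsProbabilityMeasure ν₂] {B : Set (Rn n)}
    (hB : MeasurableSet B)
    (h : ∀ᵐ q ∂ν₂, ∀ᵐ p ∂ν₁, ∀ w ∈ B, 1 ≤ segmentIntegral ρ p w + segmentIntegral ρ q w) :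
    volume B ≤ (∫⁻ p, (∫⁻ w in B, segmentIntegral ρ p w) ∂ν₁) +
      ∫⁻ q, (∫⁻ w in B, segmentIntegral ρ q w) ∂ν₂ := by
  have havg : ∀ᵐ q ∂ν₂, volume B ≤ (∫⁻ p, (∫⁻ w in B, segmentIntegral ρ p w) ∂ν₁) +
      ∫⁻ w in B, segmentIntegral ρ q w := by
    filter_upwards [h] with q hq
    calc volume B = ∫⁻ _, volume B ∂ν₁ := by simp
      _ ≤ ∫⁻ p, ((∫⁻ w in B, segmentIntegral ρ p w) + ∫⁻ w in B, segmentIntegral ρ q w) ∂ν₁ := by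
          refine lintegral_mono_ae ?_
          filter_upwards [hq] with p hp
          rw [← lintegral_add_left (measurable_segmentIntegral hρ p), ← setLIntegral_one]
          exact setLIntegral_mono' hB hp
      _ = _ := by
          rw [lintegral_add_right _ measurable_const, lintegral_const, measure_univ, mul_one]
  calc volume B = ∫⁻ _, volume B ∂ν₂ := by simp
    _ ≤ ∫⁻ q, ((∫⁻ p, (∫⁻ w in B, segmentIntegral ρ p w) ∂ν₁) +
        ∫⁻ w in B, segmentIntegral ρ q w) ∂ν₂ := lintegral_mono_ae havg
    _ = _ := by rw [lintegral_add_left measurable_const, lintegral_const, measure_univ, mul_one]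

lemma le_two_pow_mul_of_le_add {V S X₁ X₂ : ℝ≥0∞} (hn : n ≠ 0) (hV0 : V ≠ 0) (hVt : V ≠ ⊤)
    (hX : V ≤ X₁ + X₂) (h₁ : X₁ ^ n ≤ S * V ^ (n - 1)) (h₂ : X₂ ^ n ≤ S * V ^ (n - 1)) :
    V ≤ 2 ^ n * S := by
  refine (ENNReal.mul_le_mul_iff_left (pow_ne_zero (n - 1) hV0) (ENNReal.pow_ne_top hVt)).1 ?_
  calc V * V ^ (n - 1) = V ^ n := mul_pow_sub_one hn V
    _ ≤ (2 * max X₁ X₂) ^ n := by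
        gcongr
        rw [two_mul]
        exact hX.trans (add_le_add (le_max_left _ _) (le_max_right _ _))
    _ = 2 ^ n * max X₁ X₂ ^ n := mul_pow _ _ _
    _ ≤ 2 ^ n * (S * V ^ (n - 1)) := by
        gcongr
        rcases max_choice X₁ X₂ with h | h <;> rw [h] <;> assumption
    _ = 2 ^ n * S * V ^ (n - 1) := (mul_assoc _ _ _).symm

/-- The constant in the estimate of averaged segment integrals issuing from a `c`-thick set. -/
def thickConst (n : ℕ) (c β : ℝ) : ℝ≥0∞ :=
  ENNReal.ofReal β⁻¹ *
    (1 + ∑' k : ℕ, 2⁻¹ ^ k * ((ENNReal.ofReal (c / 8) ^ β)⁻¹) ^ (k + 1)) *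
      radialIntegral n β ^ (n - 1)

lemma thickConst_ne_top (hn : 2 ≤ n) {c β : ℝ} (hβ : 0 < β)
    (hc : (ENNReal.ofReal (c / 8) ^ β)⁻¹ < 2) : thickConst n c β ≠ ⊤ :=
  ENNReal.mul_ne_top (ENNReal.mul_ne_top ENNReal.ofReal_ne_top (one_add_tsum_ne_top hc))
    (ENNReal.pow_ne_top (radialIntegral_ne_top hn hβ))

lemma IsThickAt.exists_measure_pow_lintegral_segmentIntegral_le (hn : 2 ≤ n) {F : Set (Rn n)}
    (hF : IsClosed F) {c r β ℓ : ℝ} {p₀ : Rn n} (hT : IsThickAt F c r p₀) (hc : 0 < c)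
    (hc1 : c ≤ 1) (hr : 0 < r) (hβ : 0 < β) (hℓ : 0 < ℓ) {B : Set (Rn n)} (hB : MeasurableSet B)
    (hBℓ : ∀ p ∈ Metric.closedBall p₀ r, ∀ w ∈ B, dist p w ≤ ℓ) {ρ : Rn n → ℝ≥0∞}
    (hρ : Measurable ρ) :
    ∃ ν : Measure (Rn n), IsProbabilityMeasure ν ∧
      (∀ᵐ p ∂ν, p ∈ F ∩ Metric.closedBall p₀ r) ∧
      (∫⁻ p, (∫⁻ w in B, segmentIntegral ρ p w) ∂ν) ^ n ≤
        (ENNReal.ofReal ℓ ^ n * thickConst n c β * (ENNReal.ofReal (r / ℓ) ^ β)⁻¹ *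
          ∫⁻ z, ρ z ^ n) * volume B ^ (n - 1) := by
  obtain ⟨ν, hν, hmem, hball⟩ := hT.exists_measure hF hc hc1 hr
  refine ⟨ν, hν, hmem, (pow_lintegral_segmentIntegral_le hn hρ hℓ hβ hB
    (hmem.mono fun p hp => hBℓ p hp.2)
    (lintegral_inv_dist_rpow_le (by positivity) (by linarith) hr hβ.le hball)).trans_eq ?_⟩
  rw [inv_ofReal_div_rpow hℓ hβ.le, thickConst, mul_pow]
  ring

lemma volume_ball_le_of_isThickAt (hn : 2 ≤ n) {F₁ F₂ : Set (Rn n)} (hF₁ : IsClosed F₁)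
    (hF₂ : IsClosed F₂) {c r β ℓ τ : ℝ} {p₀ q₀ w₀ : Rn n} (hT₁ : IsThickAt F₁ c r p₀)
    (hT₂ : IsThickAt F₂ c r q₀) (hc : 0 < c) (hc1 : c ≤ 1) (hr : 0 < r) (hβ : 0 < β) (hℓ : 0 < ℓ)
    (hτ : 0 < τ) {ρ : Rn n → ℝ≥0∞} (hρ : Measurable ρ)
    (hℓ₁ : ∀ p ∈ Metric.closedBall p₀ r, ∀ w ∈ Metric.ball w₀ τ, dist p w ≤ ℓ)
    (hℓ₂ : ∀ q ∈ Metric.closedBall q₀ r, ∀ w ∈ Metric.ball w₀ τ, dist q w ≤ ℓ)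
    (hadm : ∀ p ∈ F₁ ∩ Metric.closedBall p₀ r, ∀ q ∈ F₂ ∩ Metric.closedBall q₀ r,
      ∀ w ∈ Metric.ball w₀ τ, 1 ≤ segmentIntegral ρ p w + segmentIntegral ρ q w) :
    volume (Metric.ball w₀ τ) ≤ 2 ^ n * (ENNReal.ofReal ℓ ^ n * thickConst n c β *
      (ENNReal.ofReal (r / ℓ) ^ β)⁻¹ * ∫⁻ z, ρ z ^ n) := by
  have hB : MeasurableSet (Metric.ball w₀ τ) := Metric.isOpen_ball.measurableSet
  obtain ⟨ν₁, hν₁, hmem₁, hle₁⟩ := hT₁.exists_measure_pow_lintegral_segmentIntegral_le hn hF₁ hc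
    hc1 hr hβ hℓ hB hℓ₁ hρ
  obtain ⟨ν₂, hν₂, hmem₂, hle₂⟩ := hT₂.exists_measure_pow_lintegral_segmentIntegral_le hn hF₂ hc
    hc1 hr hβ hℓ hB hℓ₂ hρ
  exact le_two_pow_mul_of_le_add (by omega) (Metric.measure_ball_pos _ _ hτ).ne'
    measure_ball_lt_top.ne (volume_le_lintegral_segmentIntegral_add hρ hB
      (hmem₂.mono fun q hq => hmem₁.mono fun p hp => hadm p hp q hq)) hle₁ hle₂

lemma exists_pos_ofReal_le_of_le_mul {Ω C : ℝ≥0∞} (hΩ0 : Ω ≠ 0) (hΩt : Ω ≠ ⊤) (hC : C ≠ ⊤) :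
    ∃ κ : ℝ, 0 < κ ∧ ∀ (x : ℝ) (m : ℝ≥0∞), 0 < x → Ω ≤ C * ((ENNReal.ofReal x)⁻¹ * m) →
      ENNReal.ofReal (κ * x) ≤ m := by
  have hκt : Ω / (C + 1) ≠ ⊤ := ENNReal.div_ne_top hΩt (by simp)
  have hκ0 : Ω / (C + 1) ≠ 0 :=
    (ENNReal.div_pos hΩ0 (ENNReal.add_ne_top.2 ⟨hC, ENNReal.one_ne_top⟩)).ne'
  refine ⟨(Ω / (C + 1)).toReal, ENNReal.toReal_pos hκ0 hκt, fun x m hx h => ?_⟩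
  have hx0 : ENNReal.ofReal x ≠ 0 := (ENNReal.ofReal_pos.2 hx).ne'
  rw [ENNReal.ofReal_mul ENNReal.toReal_nonneg, ENNReal.ofReal_toReal hκt]
  calc Ω / (C + 1) * ENNReal.ofReal x
      ≤ ((ENNReal.ofReal x)⁻¹ * m) * ENNReal.ofReal x := by
        gcongr
        refine ENNReal.div_le_of_le_mul' (h.trans ?_)
        gcongr
        exact le_self_add
    _ = m := by
        rw [mul_right_comm, ENNReal.inv_mul_cancel hx0 ENNReal.ofReal_ne_top, one_mul]

theorem exists_mul_rpow_le_lintegral_of_isThickAt (hn : 2 ≤ n) {c β : ℝ} (hc : 0 < c) (hc1 : c ≤ 1)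
    (hβ : 0 < β) (hcβ : (ENNReal.ofReal (c / 8) ^ β)⁻¹ < 2) (Λ : ℝ) :
    ∃ κ : ℝ, 0 < κ ∧ ∀ (F₁ F₂ : Set (Rn n)) (p₀ q₀ w₀ : Rn n) (r τ ℓ : ℝ) (ρ : Rn n → ℝ≥0∞),
      IsClosed F₁ → IsClosed F₂ → 0 < r → 0 < τ → 0 < ℓ → ℓ ≤ Λ * τ →
      IsThickAt F₁ c r p₀ → IsThickAt F₂ c r q₀ → Measurable ρ →
      (∀ p ∈ Metric.closedBall p₀ r, ∀ w ∈ Metric.ball w₀ τ, dist p w ≤ ℓ) →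
      (∀ q ∈ Metric.closedBall q₀ r, ∀ w ∈ Metric.ball w₀ τ, dist q w ≤ ℓ) →
      (∀ p ∈ F₁ ∩ Metric.closedBall p₀ r, ∀ q ∈ F₂ ∩ Metric.closedBall q₀ r,
        ∀ w ∈ Metric.ball w₀ τ, 1 ≤ segmentIntegral ρ p w + segmentIntegral ρ q w) →
      ENNReal.ofReal (κ * (r / ℓ) ^ β) ≤ ∫⁻ z, ρ z ^ n := by
  have hC : 2 ^ n * ENNReal.ofReal Λ ^ n * thickConst n c β ≠ ⊤ := ENNReal.mul_ne_top
    (by finiteness) (thickConst_ne_top hn hβ hcβ)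
  obtain ⟨κ, hκ, hle⟩ := exists_pos_ofReal_le_of_le_mul
    (Metric.measure_ball_pos volume (0 : Rn n) one_pos).ne' measure_ball_lt_top.ne hC
  refine ⟨κ, hκ, ?_⟩
  intro F₁ F₂ p₀ q₀ w₀ r τ ℓ ρ hF₁ hF₂ hr hτ hℓ hℓΛ hT₁ hT₂ hρ hℓ₁ hℓ₂ hadm
  have hτ0 : ENNReal.ofReal τ ^ n ≠ 0 := pow_ne_zero _ (ENNReal.ofReal_pos.2 hτ).ne'
  refine hle _ _ (by positivity) ((ENNReal.mul_le_mul_iff_right hτ0 (by finiteness)).1 ?_)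
  rw [← ENNReal.ofReal_rpow_of_pos (by positivity)]
  calc ENNReal.ofReal τ ^ n * volume (Metric.ball (0 : Rn n) 1)
      = volume (Metric.ball w₀ τ) := by
        rw [Measure.addHaar_ball_of_pos _ _ hτ, finrank_euclideanSpace_fin,
          ENNReal.ofReal_pow hτ.le]
    _ ≤ 2 ^ n * (ENNReal.ofReal ℓ ^ n * thickConst n c β * (ENNReal.ofReal (r / ℓ) ^ β)⁻¹ *
          ∫⁻ z, ρ z ^ n) :=
        volume_ball_le_of_isThickAt hn hF₁ hF₂ hT₁ hT₂ hc hc1 hr hβ hℓ hτ hρ hℓ₁ hℓ₂ hadm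
    _ ≤ 2 ^ n * ((ENNReal.ofReal τ * ENNReal.ofReal Λ) ^ n * thickConst n c β *
          (ENNReal.ofReal (r / ℓ) ^ β)⁻¹ * ∫⁻ z, ρ z ^ n) := by
        gcongr
        rw [← ENNReal.ofReal_mul hτ.le, mul_comm]
        exact ENNReal.ofReal_le_ofReal hℓΛ
    _ = _ := by rw [mul_pow]; ring

end TwoSets

/-! ### Polygonal curves -/

section UnitSpeed

lemma hasUnitSpeedOn_Icc_of_isometryOn {E : Type*} [PseudoMetricSpace E] {f : ℝ → E} {a b : ℝ}
    (hf : ∀ s ∈ Icc a b, ∀ t ∈ Icc a b, dist (f s) (f t) = dist s t) :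
    HasUnitSpeedOn f (Icc a b) := by
  have hlip : LipschitzOnWith 1 f (Icc a b) := LipschitzOnWith.of_dist_le_mul fun s hs t ht => by
    rw [hf s hs t ht, NNReal.coe_one, one_mul]
  unfold HasUnitSpeedOn
  rw [hasConstantSpeedOnWith_iff_ordered]
  intro x hx y hy hxy
  have hid : eVariationOn (id : ℝ → ℝ) (Icc x y) = ENNReal.ofReal (y - x) := by simp
  rw [inter_eq_right.2 (Icc_subset_Icc hx.1 hy.2), NNReal.coe_one, one_mul]
  apply le_antisymm
  · simpa [hid] using hlip.comp_eVariationOn_le (f := f) (g := id) (s := Icc x y)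
      fun s hs => Icc_subset_Icc hx.1 hy.2 hs
  · refine le_trans (le_of_eq ?_) (eVariationOn.edist_le f (right_mem_Icc.2 hxy)
      (left_mem_Icc.2 hxy))
    rw [edist_dist, hf y hy x hx, Real.dist_eq, abs_of_nonneg (sub_nonneg.2 hxy)]

lemma hasUnitSpeedOn_Icc_mono_right {E : Type*} [PseudoEMetricSpace E] {f : ℝ → E} {a b c : ℝ}
    (h : HasUnitSpeedOn f (Icc a c)) (hb : b ≤ c) : HasUnitSpeedOn f (Icc a b) := by
  intro x hx y hy
  rw [← h (Icc_subset_Icc_right hb hx) (Icc_subset_Icc_right hb hy),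
    inter_eq_right.2 (Icc_subset_Icc hx.1 hy.2),
    inter_eq_right.2 (Icc_subset_Icc hx.1 (hy.2.trans hb))]

variable {E : Type*} [PseudoEMetricSpace E] {f : ℝ → E} {S : ℝ}

lemma image_mul_left_Icc_zero_unitInterval (hS : 0 < S) (t : I) :
    (fun u : I => S * (u : ℝ)) '' Icc 0 t = Icc 0 (S * t) := by
  have himage : ((↑) : I → ℝ) '' Icc 0 t = Icc 0 (t : ℝ) := by
    ext u
    exact ⟨by rintro ⟨u, hu, rfl⟩; exact ⟨hu.1, hu.2⟩,
      fun hu => ⟨⟨u, hu.1, hu.2.trans t.2.2⟩, hu, rfl⟩⟩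
  rw [← image_image (S * ·), himage, image_mul_left_Icc hS.le t.2.1, mul_zero]

lemma eVariationOn_comp_mul_left_of_hasUnitSpeedOn (hS : 0 < S) (hf : HasUnitSpeedOn f (Icc 0 S))
    (t : I) : eVariationOn (fun u : I => f (S * u)) (Icc 0 t) = ENNReal.ofReal (S * t) := by
  have hSt : S * (t : ℝ) ∈ Icc 0 S :=
    ⟨mul_nonneg hS.le t.2.1, mul_le_of_le_one_right hS.le t.2.2⟩
  have hmono : Monotone fun u : I => S * (u : ℝ) := fun _ _ h =>
    mul_le_mul_of_nonneg_left h hS.le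
  have hspeed := hf (left_mem_Icc.2 hS.le) hSt
  rw [inter_eq_right.2 (Icc_subset_Icc_right hSt.2), NNReal.coe_one, one_mul, sub_zero] at hspeed
  change eVariationOn (f ∘ fun u : I => S * (u : ℝ)) _ = _
  rw [eVariationOn.comp_eq_of_monotoneOn _ _ (hmono.monotoneOn _),
    image_mul_left_Icc_zero_unitInterval hS, hspeed]

variable {n : ℕ} {f : ℝ → Rn n} {γ : C(I, Rn n)}

lemma curveLength_of_hasUnitSpeedOn (hS : 0 < S) (hf : HasUnitSpeedOn f (Icc 0 S))
    (hγ : ∀ t : I, γ t = f (S * t)) : curveLength γ = ENNReal.ofReal S := by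
  have huniv : (univ : Set I) = Icc 0 1 := (Icc_bot_top (α := I)).symm
  rw [curveLength, huniv, show (γ : I → Rn n) = fun u : I => f (S * u) from funext hγ,
    eVariationOn_comp_mul_left_of_hasUnitSpeedOn hS hf, Icc.coe_one, mul_one]

lemma naturalParameterization_of_hasUnitSpeedOn (hS : 0 < S) (hf : HasUnitSpeedOn f (Icc 0 S))
    (hγ : ∀ t : I, γ t = f (S * t)) {s : ℝ} (hs : s ∈ Icc 0 S) :
    naturalParameterization γ univ 0 s = f s := by
  have hbounded : BoundedVariationOn γ univ := by
    rw [BoundedVariationOn, ← curveLength, curveLength_of_hasUnitSpeedOn hS hf hγ]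
    exact ENNReal.ofReal_ne_top
  let t : I := ⟨s / S, div_nonneg hs.1 hS.le, (div_le_one hS).2 hs.2⟩
  have hst : S * (t : ℝ) = s := mul_div_cancel₀ s hS.ne'
  have hvar : variationOnFromTo γ univ 0 t = s := by
    rw [variationOnFromTo.eq_of_le _ _ (show 0 ≤ t from t.2.1), univ_inter,
      show (γ : I → Rn n) = fun u : I => f (S * u) from funext hγ,
      eVariationOn_comp_mul_left_of_hasUnitSpeedOn hS hf, hst, ENNReal.toReal_ofReal hs.1]
  have hparam := edist_eq_zero.1 (edist_naturalParameterization_eq_zero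
    hbounded.locallyBoundedVariationOn (mem_univ (0 : I)) (mem_univ t))
  rwa [hvar, hγ, hst] at hparam

lemma lineIntegral_of_hasUnitSpeedOn (hS : 0 < S) (hf : HasUnitSpeedOn f (Icc 0 S))
    (hγ : ∀ t : I, γ t = f (S * t)) (ρ : Rn n → ℝ≥0∞) :
    lineIntegral ρ γ = ∫⁻ s in Icc 0 S, ρ (f s) := by
  rw [lineIntegral, curveLength_of_hasUnitSpeedOn hS hf hγ, ENNReal.toReal_ofReal hS.le]
  exact setLIntegral_congr_fun measurableSet_Icc fun s hs => by
    rw [naturalParameterization_of_hasUnitSpeedOn hS hf hγ hs]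

end UnitSpeed

section Polygons

variable {E : Type*} [NormedAddCommGroup E] [NormedSpace ℝ E]

/-- The polygonal curve from `p` over `w` to `q`, parametrized by arc length. -/
def polygon (p w q : E) (s : ℝ) : E :=
  if s ≤ dist p w then p + (s / dist p w) • (w - p)
  else w + ((s - dist p w) / dist w q) • (q - w)

lemma polygon_of_le {p w q : E} {s : ℝ} (hs : s ≤ dist p w) :
    polygon p w q s = p + (s / dist p w) • (w - p) := if_pos hs

lemma add_dist_div_dist_smul_sub (p w : E) : p + (dist p w / dist p w) • (w - p) = w := by
  rcases eq_or_ne p w with rfl | hpw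
  · simp
  · rw [div_self (dist_ne_zero.2 hpw), one_smul, add_sub_cancel]

lemma polygon_of_ge {p w q : E} {s : ℝ} (hs : dist p w ≤ s) :
    polygon p w q s = w + ((s - dist p w) / dist w q) • (q - w) := by
  rcases hs.eq_or_lt with rfl | hs
  · rw [polygon_of_le le_rfl, sub_self, zero_div, zero_smul, add_zero, add_dist_div_dist_smul_sub]
  · exact if_neg (not_le.2 hs)

lemma polygon_zero (p w q : E) : polygon p w q 0 = p := by
  rw [polygon_of_le dist_nonneg, zero_div, zero_smul, add_zero]

lemma polygon_dist_add_dist (p w q : E) : polygon p w q (dist p w + dist w q) = q := by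
  rw [polygon_of_ge (le_add_of_nonneg_right dist_nonneg), add_sub_cancel_left,
    add_dist_div_dist_smul_sub]

lemma dist_add_div_dist_smul_sub (x y : E) {s t a : ℝ} (hs : s ∈ Icc a (a + dist x y))
    (ht : t ∈ Icc a (a + dist x y)) :
    dist (x + ((s - a) / dist x y) • (y - x)) (x + ((t - a) / dist x y) • (y - x)) = dist s t := by
  rcases eq_or_ne x y with rfl | hxy
  · rw [dist_self, add_zero, Icc_self, mem_singleton_iff] at hs ht
    simp [hs, ht]
  · have hpos : 0 < dist x y := dist_pos.2 hxy
    rw [dist_add_left, dist_eq_norm, ← sub_smul, norm_smul, ← dist_eq_norm y, dist_comm y,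
      ← sub_div, sub_sub_sub_cancel_right, Real.norm_eq_abs, abs_div, abs_of_pos hpos,
      div_mul_cancel₀ _ hpos.ne', Real.dist_eq]

lemma hasUnitSpeedOn_polygon (p w q : E) :
    HasUnitSpeedOn (polygon p w q) (Icc 0 (dist p w + dist w q)) := by
  refine HasUnitSpeedOn.Icc_Icc (y := dist p w)
    (hasUnitSpeedOn_Icc_of_isometryOn fun s hs t ht => ?_)
    (hasUnitSpeedOn_Icc_of_isometryOn fun s hs t ht => ?_)
  · rw [polygon_of_le hs.2, polygon_of_le ht.2]
    simpa using dist_add_div_dist_smul_sub p w (a := 0) (by simpa using hs) (by simpa using ht)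
  · rw [polygon_of_ge hs.1, polygon_of_ge ht.1]
    exact dist_add_div_dist_smul_sub w q hs ht

@[fun_prop]
lemma continuous_polygon (p w q : E) : Continuous (polygon p w q) := by
  refine Continuous.if_le (by fun_prop) (by fun_prop) continuous_id continuous_const fun s hs => ?_
  rw [← polygon_of_le (q := q) hs.le, polygon_of_ge hs.ge]

end Polygons

section PolygonIntegral

variable {n : ℕ}

lemma setLIntegral_Icc_comp_sub_div (h : ℝ → ℝ≥0∞) (a : ℝ) {ℓ : ℝ} (hℓ : 0 ≤ ℓ) :
    ∫⁻ s in Icc a (a + ℓ), h ((s - a) / ℓ) = ENNReal.ofReal ℓ * ∫⁻ t in Ioo (0 : ℝ) 1, h t := by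
  rcases hℓ.eq_or_lt with rfl | hℓ
  · simp
  have himage : (fun t : ℝ => ℓ * t + a) '' Ioo 0 1 = Ioo a (a + ℓ) := by
    rw [image_affine_Ioo hℓ, mul_zero, zero_add, mul_one, add_comm]
  have hderiv : ∀ t ∈ Ioo (0 : ℝ) 1, HasDerivWithinAt (fun t : ℝ => ℓ * t + a) ℓ (Ioo 0 1) t :=
    fun t _ => by simpa using (((hasDerivAt_id t).const_mul ℓ).add_const a).hasDerivWithinAt
  have hinj : InjOn (fun t : ℝ => ℓ * t + a) (Ioo 0 1) := fun s _ t _ hst =>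
    mul_left_cancel₀ hℓ.ne' (add_right_cancel hst)
  rw [← setLIntegral_congr Ioo_ae_eq_Icc, ← himage,
    lintegral_image_eq_lintegral_abs_deriv_mul measurableSet_Ioo hderiv hinj,
    ← lintegral_const_mul' _ _ ENNReal.ofReal_ne_top]
  refine lintegral_congr fun t => ?_
  rw [abs_of_pos hℓ, add_sub_cancel_right, mul_div_cancel_left₀ t hℓ.ne']

lemma segmentIntegral_comm (ρ : Rn n → ℝ≥0∞) (p q : Rn n) :
    segmentIntegral ρ p q = segmentIntegral ρ q p := by
  have himage : (fun t : ℝ => 1 - t) '' Ioo 0 1 = Ioo 0 1 := by simp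
  have hderiv : ∀ t ∈ Ioo (0 : ℝ) 1, HasDerivWithinAt (fun t : ℝ => 1 - t) (-1) (Ioo 0 1) t :=
    fun t _ => ((hasDerivAt_id t).const_sub 1).hasDerivWithinAt
  rw [segmentIntegral, segmentIntegral, dist_comm, ← himage,
    lintegral_image_eq_lintegral_abs_deriv_mul measurableSet_Ioo hderiv
      sub_right_injective.injOn, himage]
  congr 1
  refine lintegral_congr fun t => ?_
  rw [abs_neg, abs_one, ENNReal.ofReal_one, one_mul]
  congr 1
  module

lemma lintegral_polygon_le (ρ : Rn n → ℝ≥0∞) (p w q : Rn n) :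
    ∫⁻ s in Icc 0 (dist p w + dist w q), ρ (polygon p w q s) ≤
      segmentIntegral ρ p w + segmentIntegral ρ q w := by
  have hfirst : ∫⁻ s in Icc 0 (dist p w), ρ (polygon p w q s) = segmentIntegral ρ p w := by
    rw [segmentIntegral, ← setLIntegral_Icc_comp_sub_div _ 0 dist_nonneg, zero_add]
    exact setLIntegral_congr_fun measurableSet_Icc fun s hs => by
      rw [polygon_of_le hs.2, sub_zero]
  have hsecond : ∫⁻ s in Icc (dist p w) (dist p w + dist w q), ρ (polygon p w q s) =
      segmentIntegral ρ q w := by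
    rw [segmentIntegral_comm, segmentIntegral,
      ← setLIntegral_Icc_comp_sub_div _ (dist p w) dist_nonneg]
    exact setLIntegral_congr_fun measurableSet_Icc fun s hs => by rw [polygon_of_ge hs.1]
  rw [← hfirst, ← hsecond]
  exact (lintegral_mono_set Icc_subset_Icc_union_Icc).trans (lintegral_union_le _ _ _)

lemma exists_first_mem_frontier {X : Type*} [TopologicalSpace X] {G : Set X} (hG : IsOpen G)
    {f : ℝ → X} {a b : ℝ} (hf : ContinuousOn f (Icc a b)) (hab : a ≤ b) (ha : f a ∈ G)
    (hb : f b ∈ frontier G) :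
    ∃ s ∈ Ioc a b, f s ∈ frontier G ∧ ∀ t ∈ Ico a s, f t ∈ G := by
  have hcompact : IsCompact (Icc a b ∩ f ⁻¹' frontier G) :=
    isCompact_Icc.of_isClosed_subset (hf.preimage_isClosed_of_isClosed isClosed_Icc
      isClosed_frontier) inter_subset_left
  obtain ⟨s, ⟨hs, hsfr⟩, hmin⟩ := hcompact.exists_isLeast ⟨b, right_mem_Icc.2 hab, hb⟩
  have has : a < s := lt_of_le_of_ne hs.1 fun h =>
    disjoint_left.1 (disjoint_frontier_of_isOpen hG) ha (by rwa [h])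
  refine ⟨s, ⟨has, hs.2⟩, hsfr, ?_⟩
  have hsub : Ico a s ⊆ Icc a b := fun t ht => ⟨ht.1, ht.2.le.trans hs.2⟩
  refine fun t ht => subset_of_isPreconnected_of_disjoint_frontier
    (isPreconnected_Ico.image f (hf.mono hsub)) hG ?_
    ⟨f a, mem_image_of_mem f (left_mem_Ico.2 has), ha⟩ (mem_image_of_mem f ht)
  rw [disjoint_left]
  rintro _ ⟨t, ht, rfl⟩ htfr
  exact ht.2.not_ge (hmin ⟨hsub ht, htfr⟩)

lemma one_le_segmentIntegral_add {G C : Set (MobiusSpace n)} (hG : IsOpen G) (hC : C ⊆ G)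
    {ρ : Rn n → ℝ≥0∞} (hρ : IsAdmissible (joiningCurves C (frontier G) G) ρ) {p q : Rn n}
    (hp : (p : MobiusSpace n) ∈ C) (hq : (q : MobiusSpace n) ∈ frontier G) (w : Rn n) :
    1 ≤ segmentIntegral ρ p w + segmentIntegral ρ q w := by
  have hcont : Continuous fun s => ((polygon p w q s : Rn n) : MobiusSpace n) :=
    OnePoint.continuous_coe.comp (continuous_polygon p w q)
  obtain ⟨S, hS, hSfr, hSG⟩ := exists_first_mem_frontier hG
    (hcont.continuousOn (s := Icc 0 (dist p w + dist w q))) (by positivity)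
    (by rw [polygon_zero]; exact hC hp) (by rwa [polygon_dist_add_dist])
  let γ : C(I, Rn n) := ⟨fun t => polygon p w q (S * t), by fun_prop⟩
  have hspeed : HasUnitSpeedOn (polygon p w q) (Icc 0 S) :=
    hasUnitSpeedOn_Icc_mono_right (hasUnitSpeedOn_polygon p w q) hS.2
  have hlength : curveLength γ ≠ ⊤ := by
    rw [curveLength_of_hasUnitSpeedOn hS.1 hspeed fun _ => rfl]
    exact ENNReal.ofReal_ne_top
  have hγ : finiteCurve γ ∈ joiningCurves C (frontier G) G := by
    refine ⟨?_, ?_, fun t _ ht =>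
      hSG _ ⟨mul_nonneg hS.1.le t.2.1, mul_lt_of_lt_one_right hS.1 (by exact_mod_cast ht)⟩⟩
    · simpa [finiteCurve, γ, polygon_zero] using hp
    · simpa [finiteCurve, γ] using hSfr
  calc 1 ≤ lineIntegral ρ γ := hρ.2 γ hγ hlength
    _ = ∫⁻ s in Icc 0 S, ρ (polygon p w q s) :=
        lineIntegral_of_hasUnitSpeedOn hS.1 hspeed (fun _ => rfl) ρ
    _ ≤ ∫⁻ s in Icc 0 (dist p w + dist w q), ρ (polygon p w q s) :=
        lintegral_mono_set (Icc_subset_Icc_right hS.2)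
    _ ≤ segmentIntegral ρ p w + segmentIntegral ρ q w := lintegral_polygon_le ρ p w q

end PolygonIntegral

/-! ### Segments in a spherical shell -/

section Shell

variable {E : Type*} [NormedAddCommGroup E] [InnerProductSpace ℝ E]

lemma exists_norm_eq_inner_nonneg (hE : 1 < Module.rank ℝ E) (u u' : E) {r : ℝ} (hr : 0 ≤ r) :
    ∃ v : E, ‖v‖ = r ∧ 0 ≤ inner ℝ u v ∧ 0 ≤ inner ℝ u' v := by
  have hspan : Submodule.span ℝ {u} ≠ ⊤ := fun htop => by
    have hrank := rank_span_le (R := ℝ) {u}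
    rw [htop, rank_top, Cardinal.mk_singleton] at hrank
    exact hrank.not_gt hE
  have : Nontrivial (Submodule.span ℝ {u})ᗮ :=
    Submodule.nontrivial_iff_ne_bot.2 fun hbot => hspan (Submodule.orthogonal_eq_bot_iff.1 hbot)
  obtain ⟨⟨v, hv⟩, hvr⟩ := exists_norm_eq (Submodule.span ℝ {u})ᗮ hr
  have huv : inner ℝ u v = 0 := Submodule.mem_orthogonal_singleton_iff_inner_right.1 hv
  rcases le_total 0 (inner ℝ u' v) with h | h
  · exact ⟨v, hvr, huv.ge, h⟩
  · exact ⟨-v, by rwa [norm_neg], by rw [inner_neg_right, huv, neg_zero],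
      by rwa [inner_neg_right, neg_nonneg]⟩

lemma half_le_norm_of_inner_nonneg {x y : E} {m t : ℝ} (hm : 0 ≤ m) (hx : m ≤ ‖x‖) (hy : m ≤ ‖y‖)
    (hxy : 0 ≤ inner ℝ x y) (ht : t ∈ Icc (0 : ℝ) 1) : m / 2 ≤ ‖(1 - t) • x + t • y‖ := by
  obtain ⟨ht0, ht1⟩ := ht
  have ht1' : 0 ≤ 1 - t := sub_nonneg.2 ht1
  refine le_of_sq_le_sq ?_ (norm_nonneg _)
  calc (m / 2) ^ 2 = m ^ 2 * (1 / 4) := by ring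
    _ ≤ m ^ 2 * ((1 - t) ^ 2 + t ^ 2) := by
        gcongr
        nlinarith [sq_nonneg (2 * t - 1)]
    _ = (1 - t) ^ 2 * m ^ 2 + 2 * 0 + t ^ 2 * m ^ 2 := by ring
    _ ≤ (1 - t) ^ 2 * ‖x‖ ^ 2 + 2 * ((1 - t) * (t * inner ℝ x y)) + t ^ 2 * ‖y‖ ^ 2 := by
        gcongr
        positivity
    _ = ‖(1 - t) • x + t • y‖ ^ 2 := by
        rw [norm_add_sq_real, norm_smul, norm_smul, real_inner_smul_left, real_inner_smul_right,
          Real.norm_of_nonneg ht1', Real.norm_of_nonneg ht0]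
        ring

lemma norm_convex_combination_le {x y : E} {r t : ℝ} (hx : ‖x‖ ≤ r) (hy : ‖y‖ ≤ r)
    (ht : t ∈ Icc (0 : ℝ) 1) : ‖(1 - t) • x + t • y‖ ≤ r :=
  mem_closedBall_zero_iff.1 (convex_closedBall (0 : E) r (mem_closedBall_zero_iff.2 hx)
    (mem_closedBall_zero_iff.2 hy) (sub_nonneg.2 ht.2) ht.1 (sub_add_cancel 1 t))

lemma add_smul_sub_mem_shell {a P Q p w : E} {m R t : ℝ} (hm : 0 < m) (hP : dist P a ∈ Icc m R)
    (hQ : dist Q a ∈ Icc m R) (hPQ : 0 ≤ inner ℝ (P - a) (Q - a)) (hp : dist p P ≤ m / 8)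
    (hw : dist w Q ≤ m / 8) (ht : t ∈ Icc (0 : ℝ) 1) :
    p + t • (w - p) ∈ shell a (m / 4) (2 * R) := by
  rw [dist_eq_norm] at hP hQ hp hw
  set A := (1 - t) • (P - a) + t • (Q - a)
  set B := (1 - t) • (p - P) + t • (w - Q)
  have hsum : p + t • (w - p) - a = A + B := by module
  have hA : m / 2 ≤ ‖A‖ := half_le_norm_of_inner_nonneg hm.le hP.1 hQ.1 hPQ ht
  have hA' : ‖A‖ ≤ R := norm_convex_combination_le hP.2 hQ.2 ht
  have hB : ‖B‖ ≤ m / 8 := norm_convex_combination_le hp hw ht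
  have hlower := norm_sub_le (A + B) B
  rw [add_sub_cancel_right] at hlower
  have hupper := norm_add_le A B
  rw [shell, mem_ofPred_eq, dist_eq_norm, hsum]
  exact ⟨by linarith, by linarith [hP.1.trans hP.2]⟩

end Shell

/-! ### Lower bounds for the modulus near a uniformly perfect set -/

section LowerBound

lemma exists_exponent_inv_rpow_lt_two {c : ℝ} (hc : 0 < c) (hc1 : c < 1) :
    ∃ β : ℝ, 0 < β ∧ β ≤ 1 ∧ (ENNReal.ofReal c ^ β)⁻¹ < 2 := by
  obtain ⟨m, hm⟩ := exists_pow_lt_of_lt_one hc (show (1 / 2 : ℝ) < 1 by norm_num)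
  have hm0 : m ≠ 0 := by
    rintro rfl
    rw [pow_zero] at hm
    linarith
  have hm1 : (1 : ℝ) ≤ m := by exact_mod_cast Nat.one_le_iff_ne_zero.2 hm0
  refine ⟨(m : ℝ)⁻¹, by positivity, inv_le_one_of_one_le₀ hm1, ?_⟩
  have hhalf : (1 / 2 : ℝ) < c ^ (m : ℝ)⁻¹ := by
    have := Real.rpow_lt_rpow (by positivity) hm (show 0 < (m : ℝ)⁻¹ by positivity)
    rwa [Real.pow_rpow_inv_natCast (by positivity) hm0] at this
  rw [ENNReal.ofReal_rpow_of_pos hc, ENNReal.inv_lt_iff_inv_lt, ← ENNReal.ofReal_ofNat,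
    ← ENNReal.ofReal_inv_of_pos two_pos, ← one_div]
  exact (ENNReal.ofReal_lt_ofReal_iff (by positivity)).2 hhalf

lemma isThickAt_of_isPreconnected {X : Type*} [MetricSpace X] [ProperSpace X]
    {K : Set (OnePoint X)} (hK : IsPreconnected K) {c r : ℝ} (hc1 : c ≤ 1) {p : X}
    (hp : (p : OnePoint X) ∈ K) {o : OnePoint X} (ho : o ∈ K)
    (hor : ∀ z : X, o = z → 2 * r ≤ dist z p) :
    IsThickAt {z : X | (z : OnePoint X) ∈ K} c r p := by
  refine ⟨hp, fun a ha hap s hs hsr => ?_⟩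
  obtain ⟨z, hz, hzs⟩ := exists_dist_eq_of_isPreconnected hK (a := a) (r := s) ha
    (by rw [dist_self]; exact hs.le) ho
    (fun z hz => by linarith [hor z hz, dist_triangle z a p])
  exact ⟨z, hz, by rw [hzs]; exact mul_le_of_le_one_left hs.le hc1, hzs.le⟩

lemma lintegral_indicator_pow {α : Type*} [MeasurableSpace α] (μ : Measure α) {U : Set α}
    (hU : MeasurableSet U) (f : α → ℝ≥0∞) {n : ℕ} (hn : n ≠ 0) :
    ∫⁻ z, U.indicator f z ^ n ∂μ = ∫⁻ z in U, f z ^ n ∂μ := by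
  rw [← lintegral_indicator hU]
  exact lintegral_congr fun z => by simp only [indicator, ite_pow, zero_pow hn]

variable {n : ℕ}

lemma segmentIntegral_indicator {U : Set (Rn n)} {ρ : Rn n → ℝ≥0∞} {p w : Rn n}
    (h : ∀ t ∈ Icc (0 : ℝ) 1, p + t • (w - p) ∈ U) :
    segmentIntegral (U.indicator ρ) p w = segmentIntegral ρ p w := by
  unfold segmentIntegral
  congr 1
  exact setLIntegral_congr_fun measurableSet_Ioo fun t ht =>
    indicator_of_mem (h t (Ioo_subset_Icc_self ht)) ρ

lemma segmentIntegral_indicator_shell {a P Q p w : Rn n} {m R : ℝ} (ρ : Rn n → ℝ≥0∞) (hm : 0 < m)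
    (hP : dist P a ∈ Icc m R) (hQ : dist Q a ∈ Icc m R) (hPQ : 0 ≤ inner ℝ (P - a) (Q - a))
    (hp : dist p P ≤ m / 8) (hw : dist w Q ≤ m / 8) :
    segmentIntegral ((shell a (m / 4) (2 * R)).indicator ρ) p w = segmentIntegral ρ p w :=
  segmentIntegral_indicator fun _ => add_smul_sub_mem_shell hm hP hQ hPQ hp hw

/-- The data of the lower estimates for the modulus: a closed set `F` meeting all rings of ratio `c`
and outer radius below `R` around its points, a continuum `K` reaching from `x` to distance `R`
(possibly through `∞`), a point `a` of `F`, and a density `ρ` which integrates to at least `1` over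
each two-segment polygon from `K` to `F`. -/
structure JoiningConfiguration (c : ℝ) (F : Set (Rn n)) (K : Set (MobiusSpace n))
    (ρ : Rn n → ℝ≥0∞) (x a : Rn n) (R : ℝ) : Prop where
  radius_pos : 0 < R
  isClosed_set : IsClosed F
  exists_mem_ring : ∀ q ∈ F, ∀ s, 0 < s → s < R → ∃ y ∈ F, c * s ≤ dist y q ∧ dist y q ≤ s
  isClosed_continuum : IsClosed K
  isPreconnected_continuum : IsPreconnected K
  source_mem : (x : MobiusSpace n) ∈ K
  exists_far : ∃ o ∈ K, ∀ z : Rn n, o = z → R ≤ dist z x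
  center_mem : a ∈ F
  source_ne_center : x ≠ a
  measurable_density : Measurable ρ
  one_le_segmentIntegral_add : ∀ p : Rn n, (p : MobiusSpace n) ∈ K → ∀ q ∈ F, ∀ w,
    1 ≤ segmentIntegral ρ p w + segmentIntegral ρ q w

namespace JoiningConfiguration

variable {c : ℝ} {F : Set (Rn n)} {K : Set (MobiusSpace n)} {ρ : Rn n → ℝ≥0∞} {x a : Rn n} {R : ℝ}

lemma isThickAt (h : JoiningConfiguration c F K ρ x a R) {q : Rn n} (hq : q ∈ F) {r : ℝ}
    (hr : r < R) : IsThickAt F c r q :=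
  ⟨hq, fun b hb _ s hs hsr => h.exists_mem_ring b hb s hs (hsr.trans_lt hr)⟩

lemma exists_mem_continuum_dist_eq (h : JoiningConfiguration c F K ρ x a R) {r : ℝ}
    (hxr : dist x a ≤ r) (hrR : r + dist x a ≤ R) :
    ∃ p : Rn n, (p : MobiusSpace n) ∈ K ∧ dist p a = r := by
  obtain ⟨o, ho, hfar⟩ := h.exists_far
  refine exists_dist_eq_of_isPreconnected h.isPreconnected_continuum h.source_mem hxr ho
    fun z hz => ?_
  linarith [hfar z hz, dist_triangle_right z x a]

lemma dist_pos (h : JoiningConfiguration c F K ρ x a R) : 0 < dist x a :=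
  _root_.dist_pos.2 h.source_ne_center

lemma one_le_segmentIntegral_indicator_shell_add (h : JoiningConfiguration c F K ρ x a R)
    {m r : ℝ} (hm : 0 < m) {P Q W p q w : Rn n} (hP : dist P a ∈ Icc m r)
    (hQ : dist Q a ∈ Icc m r) (hW : dist W a ∈ Icc m r) (hPW : 0 ≤ inner ℝ (P - a) (W - a))
    (hQW : 0 ≤ inner ℝ (Q - a) (W - a)) (hp : (p : MobiusSpace n) ∈ K) (hpP : dist p P ≤ m / 8)
    (hq : q ∈ F) (hqQ : dist q Q ≤ m / 8) (hwW : dist w W ≤ m / 8) :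
    1 ≤ segmentIntegral ((shell a (m / 4) (2 * r)).indicator ρ) p w +
      segmentIntegral ((shell a (m / 4) (2 * r)).indicator ρ) q w := by
  rw [segmentIntegral_indicator_shell ρ hm hP hW hPW hpP hwW,
    segmentIntegral_indicator_shell ρ hm hQ hW hQW hqQ hwW]
  exact h.one_le_segmentIntegral_add p hp q hq w

theorem exists_le_setLIntegral_shell (hn : 2 ≤ n) {c : ℝ} (hc : 0 < c) (hc1 : c ≤ 1) :
    ∃ κ : ℝ, 0 < κ ∧ ∀ {F : Set (Rn n)} {K : Set (MobiusSpace n)} {ρ : Rn n → ℝ≥0∞} {x a : Rn n}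
      {R : ℝ}, JoiningConfiguration c F K ρ x a R →
      ∀ r, 2 * dist x a ≤ r → r + dist x a ≤ R →
        ENNReal.ofReal κ ≤ ∫⁻ z in shell a (c * r / 4) (2 * r), ρ z ^ n := by
  obtain ⟨β, hβ, -, hcβ⟩ := exists_exponent_inv_rpow_lt_two (c := c / 8) (by positivity)
    (by linarith)
  obtain ⟨κ, hκ, hbound⟩ := exists_mul_rpow_le_lintegral_of_isThickAt hn hc hc1 hβ hcβ (32 / c)
  refine ⟨κ * (c / 32) ^ β, by positivity, fun {F K ρ x a R} h r hxr hrR => ?_⟩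
  have hs : 0 < dist x a := h.dist_pos
  have hr : 0 < r := by linarith
  have hcr : c * r ≤ r := mul_le_of_le_one_left hr.le hc1
  have hcr0 : 0 < c * r := by positivity
  obtain ⟨p₀, hp₀K, hp₀⟩ := h.exists_mem_continuum_dist_eq (r := r) (by linarith) hrR
  obtain ⟨q₀, hq₀F, hq₀⟩ := h.exists_mem_ring a h.center_mem r hr (by linarith)
  obtain ⟨v, hv, hpv, hqv⟩ :=
    exists_norm_eq_inner_nonneg (one_lt_rank_Rn hn) (p₀ - a) (q₀ - a) hr.le
  have hva : dist (a + v) a = r := by rw [dist_eq_norm, add_sub_cancel_left, hv]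
  have hdist : ∀ P : Rn n, dist P a ≤ r → ∀ p ∈ Metric.closedBall P (c * r / 8),
      ∀ w ∈ Metric.ball (a + v) (c * r / 8), dist p w ≤ 4 * r := by
    intro P hP p hp w hw
    rw [Metric.mem_closedBall] at hp
    rw [Metric.mem_ball] at hw
    linarith [dist_triangle4 p P a (a + v), dist_triangle_right p w (a + v), dist_comm a (a + v)]
  have hthick : IsThickAt {z : Rn n | (z : MobiusSpace n) ∈ K} c (c * r / 8) p₀ :=
    isThickAt_of_isPreconnected h.isPreconnected_continuum hc1 hp₀K h.source_mem fun z hz => by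
      obtain rfl := OnePoint.coe_eq_coe.1 hz
      linarith [dist_triangle_left p₀ a x]
  calc ENNReal.ofReal (κ * (c / 32) ^ β) = ENNReal.ofReal (κ * (c * r / 8 / (4 * r)) ^ β) := by
        congr 3
        field_simp
        norm_num
    _ ≤ ∫⁻ z, (shell a (c * r / 4) (2 * r)).indicator ρ z ^ n :=
        hbound _ F p₀ q₀ (a + v) (c * r / 8) (c * r / 8) (4 * r) _
          (h.isClosed_continuum.preimage OnePoint.continuous_coe) h.isClosed_set (by positivity)
          (by positivity) (by positivity) (by field_simp; norm_num) hthick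
          (h.isThickAt hq₀F (by linarith))
          (h.measurable_density.indicator (measurableSet_shell a _ _))
          (hdist p₀ hp₀.le) (hdist q₀ hq₀.2) fun p hp q hq w hw =>
            h.one_le_segmentIntegral_indicator_shell_add hcr0 ⟨hp₀ ▸ hcr, hp₀.le⟩ hq₀
              ⟨hva ▸ hcr, hva.le⟩ (by rwa [add_sub_cancel_left]) (by rwa [add_sub_cancel_left])
              hp.1 hp.2 hq.1 hq.2 (Metric.mem_ball.1 hw).le
    _ = ∫⁻ z in shell a (c * r / 4) (2 * r), ρ z ^ n :=
        lintegral_indicator_pow volume (measurableSet_shell a _ _) ρ (by lia)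

theorem exists_mul_natCast_le_lintegral (hn : 2 ≤ n) {c : ℝ} (hc : 0 < c) (hc1 : c ≤ 1) :
    ∃ κ : ℝ, 0 < κ ∧ ∀ {F : Set (Rn n)} {K : Set (MobiusSpace n)} {ρ : Rn n → ℝ≥0∞} {x a : Rn n}
      {R : ℝ}, JoiningConfiguration c F K ρ x a R →
      ∀ N : ℕ, (8 / c) ^ N * dist x a + dist x a ≤ R →
        ENNReal.ofReal (κ * N) ≤ ∫⁻ z, ρ z ^ n := by
  obtain ⟨κ, hκ, hshell⟩ := exists_le_setLIntegral_shell hn hc hc1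
  refine ⟨κ, hκ, fun {F K ρ x a R} h N hN => ?_⟩
  have hs : 0 < dist x a := h.dist_pos
  have h8 : 8 ≤ 8 / c := by rw [le_div_iff₀ hc]; linarith
  have h1 : 1 ≤ 8 / c := by linarith
  have hterm : ∀ k ∈ Finset.Ico 0 N, ENNReal.ofReal κ ≤
      ∫⁻ z in shell a ((8 / c) ^ k * (2 * dist x a)) ((8 / c) ^ (k + 1) * (2 * dist x a)),
        ρ z ^ n := by
    intro k hk
    have hkN : k + 1 ≤ N := (Finset.mem_Ico.1 hk).2
    have hlower : 2 ≤ (8 / c) ^ (k + 1) :=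
      (show (2 : ℝ) ≤ 8 / c by linarith).trans (le_self_pow₀ h1 k.succ_ne_zero)
    have hupper : (8 / c) ^ (k + 1) * dist x a ≤ (8 / c) ^ N * dist x a := by gcongr
    convert hshell h ((8 / c) ^ (k + 1) * dist x a) (by gcongr) (by linarith) using 4
    · rw [pow_succ]
      field_simp
      norm_num
    · ring
  calc ENNReal.ofReal (κ * N) = ∑ _k ∈ Finset.Ico 0 N, ENNReal.ofReal κ := by
        rw [Finset.sum_const, Nat.card_Ico, Nat.sub_zero, nsmul_eq_mul, ENNReal.ofReal_mul hκ.le,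
          ENNReal.ofReal_natCast, mul_comm]
    _ ≤ _ := Finset.sum_le_sum hterm
    _ = ∫⁻ z in shell a _ _, ρ z ^ n :=
        (lintegral_shell_eq_sum volume _ a h1 (by positivity) 0 N).symm
    _ ≤ ∫⁻ z, ρ z ^ n := setLIntegral_le_lintegral _ _

theorem exists_mul_div_add_le_lintegral (hn : 2 ≤ n) {c : ℝ} (hc : 0 < c) (hc1 : c ≤ 1) :
    ∃ κ : ℝ, 0 < κ ∧ ∀ {F : Set (Rn n)} {K : Set (MobiusSpace n)} {ρ : Rn n → ℝ≥0∞} {x a : Rn n}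
      {R : ℝ}, JoiningConfiguration c F K ρ x a R →
        ENNReal.ofReal (κ * (R / (dist x a + R))) ≤ ∫⁻ z, ρ z ^ n := by
  obtain ⟨β, hβ, hβ1, hcβ⟩ := exists_exponent_inv_rpow_lt_two (c := c / 8) (by positivity)
    (by linarith)
  obtain ⟨κ, hκ, hbound⟩ := exists_mul_rpow_le_lintegral_of_isThickAt hn hc hc1 hβ hcβ 2
  refine ⟨κ / 8, by positivity, fun {F K ρ x a R} h => ?_⟩
  have hR : 0 < R := h.radius_pos
  have hs : 0 < dist x a := h.dist_pos
  obtain ⟨o, ho, hfar⟩ := h.exists_far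
  have hratio : R / 4 / (2 * (dist x a + R)) ≤ (R / 4 / (2 * (dist x a + R))) ^ β := by
    refine Real.self_le_rpow_of_le_one (by positivity) ?_ hβ1
    rw [div_le_one (by positivity)]
    linarith
  calc ENNReal.ofReal (κ / 8 * (R / (dist x a + R)))
      = ENNReal.ofReal (κ * (R / 4 / (2 * (dist x a + R)))) := by
        congr 1
        field_simp
        norm_num
    _ ≤ ENNReal.ofReal (κ * (R / 4 / (2 * (dist x a + R))) ^ β) := by gcongr
    _ ≤ ∫⁻ z, ρ z ^ n :=
        hbound {z : Rn n | (z : MobiusSpace n) ∈ K} F x a x (R / 4) (dist x a + R) _ ρ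
          (h.isClosed_continuum.preimage OnePoint.continuous_coe) h.isClosed_set (by positivity)
          (by positivity) (by positivity) le_rfl
          (isThickAt_of_isPreconnected h.isPreconnected_continuum hc1 h.source_mem ho
            fun z hz => by linarith [hfar z hz])
          (h.isThickAt h.center_mem (by linarith)) h.measurable_density
          (fun p hp w hw => by
            rw [Metric.mem_closedBall] at hp
            rw [Metric.mem_ball] at hw
            linarith [dist_triangle_right p w x])
          (fun q hq w hw => by
            rw [Metric.mem_closedBall] at hq
            rw [Metric.mem_ball] at hw
            linarith [dist_triangle4 q a x w, dist_comm a x, dist_comm x w])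
          (fun p hp q hq w _ => h.one_le_segmentIntegral_add p hp.1 q hq.1 w)

end JoiningConfiguration

lemma log_one_add_div_le_of_le_mul {s R L : ℝ} (hs : 0 < s) (hR : 0 < R) (hL : R ≤ (L + 1) * s) :
    Real.log (1 + R / s) ≤ (L + 2) * (R / (s + R)) := by
  calc Real.log (1 + R / s) ≤ R / s := by
        linarith [Real.log_le_sub_one_of_pos (show 0 < 1 + R / s by positivity)]
    _ ≤ (L + 2) * (R / (s + R)) := by
        rw [mul_div_assoc', div_le_div_iff₀ hs (by positivity)]
        nlinarith

lemma exists_pow_mul_add_le_and_log_le {s R L : ℝ} (hs : 0 < s) (hL : 8 ≤ L)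
    (hR : (L + 1) * s < R) :
    ∃ N : ℕ, L ^ N * s + s ≤ R ∧ Real.log (1 + R / s) ≤ 3 * Real.log L * N := by
  have hlogL : 0 < Real.log L := Real.log_pos (by linarith)
  have hLs : L < (R - s) / s := by
    rw [lt_div_iff₀ hs]
    linarith
  obtain ⟨N, hN, hN'⟩ := exists_nat_pow_near (show 1 ≤ (R - s) / s by linarith)
    (show 1 < L by linarith)
  have hN1 : (1 : ℝ) ≤ N := by
    rw [Nat.one_le_cast, Nat.one_le_iff_ne_zero]
    rintro rfl
    rw [zero_add, pow_one] at hN'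
    linarith
  refine ⟨N, by rw [le_div_iff₀ hs] at hN; linarith, ?_⟩
  have hLN : 8 ≤ L ^ (N + 1) := hL.trans (le_self_pow₀ (by linarith) N.succ_ne_zero)
  have hpow : 1 + R / s ≤ L ^ (N + 2) := by
    have hRs : R / s = (R - s) / s + 1 := by
      field_simp
      ring
    rw [hRs, pow_succ L (N + 1)]
    nlinarith [hLN]
  have hRs0 : 0 < 1 + R / s := by
    have : 0 < R := by nlinarith
    positivity
  calc Real.log (1 + R / s) ≤ (N + 2) * Real.log L := by
        simpa [Real.log_pow] using Real.log_le_log hRs0 hpow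
    _ ≤ 3 * Real.log L * N := by nlinarith

theorem JoiningConfiguration.exists_mul_log_le_lintegral (hn : 2 ≤ n) {c : ℝ} (hc : 0 < c)
    (hc1 : c ≤ 1) :
    ∃ κ : ℝ, 0 < κ ∧ ∀ {F : Set (Rn n)} {K : Set (MobiusSpace n)} {ρ : Rn n → ℝ≥0∞} {x a : Rn n}
      {R : ℝ}, JoiningConfiguration c F K ρ x a R →
        ENNReal.ofReal (κ * Real.log (1 + R / dist x a)) ≤ ∫⁻ z, ρ z ^ n := by
  obtain ⟨κ₁, hκ₁, hlinear⟩ := exists_mul_div_add_le_lintegral hn hc hc1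
  obtain ⟨κ₂, hκ₂, hshells⟩ := exists_mul_natCast_le_lintegral hn hc hc1
  have h8 : 8 ≤ 8 / c := by rw [le_div_iff₀ hc]; linarith
  have hlog8 : 0 < Real.log (8 / c) := Real.log_pos (by linarith)
  refine ⟨min (κ₁ / (8 / c + 2)) (κ₂ / (3 * Real.log (8 / c))), by positivity,
    fun {F K ρ x a R} h => ?_⟩
  have hs : 0 < dist x a := h.dist_pos
  have hR : 0 < R := h.radius_pos
  have hlog : 0 ≤ Real.log (1 + R / dist x a) :=
    Real.log_nonneg (le_add_of_nonneg_right (by positivity))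
  rcases le_or_gt R ((8 / c + 1) * dist x a) with hnear | hfar
  · refine (ENNReal.ofReal_le_ofReal ?_).trans (hlinear h)
    calc _ ≤ κ₁ / (8 / c + 2) * ((8 / c + 2) * (R / (dist x a + R))) := by
          gcongr
          · exact min_le_left _ _
          · exact log_one_add_div_le_of_le_mul hs hR hnear
      _ = κ₁ * (R / (dist x a + R)) := by
          rw [← mul_assoc, div_mul_cancel₀ _ (by positivity)]
  · obtain ⟨N, hN, hlogN⟩ := exists_pow_mul_add_le_and_log_le hs h8 hfar
    refine (ENNReal.ofReal_le_ofReal ?_).trans (hshells h N hN)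
    calc _ ≤ κ₂ / (3 * Real.log (8 / c)) * (3 * Real.log (8 / c) * N) := by
          gcongr
          exact min_le_right _ _
      _ = κ₂ * N := by rw [← mul_assoc, div_mul_cancel₀ _ (by positivity)]

end LowerBound

/-! ### The modulus metric of a domain with uniformly perfect boundary -/

section Direct

variable {n : ℕ}

lemma euclideanDiam_pos {E : Set (MobiusSpace n)} (hE : E.Nontrivial) : 0 < euclideanDiam E := by
  by_cases hinf : OnePoint.infty ∈ E
  · rw [euclideanDiam, if_pos hinf]
    exact ENNReal.zero_lt_top
  · rw [euclideanDiam, if_neg hinf, Metric.ediam_pos_iff']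
    obtain ⟨a, ha, b, hb, hab⟩ := hE
    obtain ⟨a', rfl⟩ := OnePoint.ne_infty_iff_exists.1 fun h => hinf (h ▸ ha)
    obtain ⟨b', rfl⟩ := OnePoint.ne_infty_iff_exists.1 fun h => hinf (h ▸ hb)
    exact ⟨a', ha, b', hb, fun h => hab (by rw [h])⟩

lemma euclideanDiam_ne_top {E : Set (MobiusSpace n)} (hE : IsClosed E)
    (hinf : OnePoint.infty ∉ E) : euclideanDiam E ≠ ⊤ := by
  rw [euclideanDiam, if_neg hinf]
  have himage : ((↑) '' {x : Rn n | (x : MobiusSpace n) ∈ E} : Set (MobiusSpace n)) = E :=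
    image_preimage_eq_of_subset fun z hz =>
      OnePoint.ne_infty_iff_exists.1 fun h => hinf (h ▸ hz)
  rw [← himage] at hE
  exact (OnePoint.isClosed_image_coe.1 hE).2.isBounded.ediam_ne_top

lemma exists_dist_le_of_euclideanDiam_le {E : Set (MobiusSpace n)} {R : ℝ}
    (hE : euclideanDiam E ≤ ENNReal.ofReal R) (hR : 0 ≤ R) {a b : MobiusSpace n} (ha : a ∈ E)
    (hb : b ∈ E) : ∃ a' b' : Rn n, a = a' ∧ b = b' ∧ dist a' b' ≤ R := by
  have hinf : OnePoint.infty ∉ E := fun h => by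
    rw [euclideanDiam, if_pos h, top_le_iff] at hE
    exact ENNReal.ofReal_ne_top hE
  obtain ⟨a', rfl⟩ := OnePoint.ne_infty_iff_exists.1 fun h => hinf (h ▸ ha)
  obtain ⟨b', rfl⟩ := OnePoint.ne_infty_iff_exists.1 fun h => hinf (h ▸ hb)
  rw [euclideanDiam, if_neg hinf] at hE
  refine ⟨a', b', rfl, rfl, (ENNReal.ofReal_le_ofReal_iff hR).1 ?_⟩
  rw [← edist_dist]
  exact (Metric.edist_le_ediam_of_mem (s := {x : Rn n | (x : MobiusSpace n) ∈ E}) ha hb).trans hE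

lemma modulusMetric_comm (G : Set (MobiusSpace n)) (x y : MobiusSpace n) :
    modulusMetric G x y = modulusMetric G y x := by
  have hle : ∀ x y : MobiusSpace n, modulusMetric G x y ≤ modulusMetric G y x :=
    fun x y => le_iInf₂ fun γ hγ => by
      have hrange : range γ.symm = range γ := γ.symm_range
      refine (iInf₂_le γ.symm (hrange.trans_subset hγ)).trans_eq ?_
      rw [hrange]
  exact le_antisymm (hle x y) (hle y x)

variable {G : Set (MobiusSpace n)}

lemma mobiusMetric_coe_infty_le_log (hG : IsOpen G) (hcard : (frontier G).Nontrivial) {x : Rn n}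
    (hx : (x : MobiusSpace n) ∈ G) {R : ℝ} (hR : 0 ≤ R)
    (hdiam : euclideanDiam (frontier G) ≤ ENNReal.ofReal R) :
    mobiusMetric G x OnePoint.infty ≤ Real.log (1 + R / Metric.infDist x (finiteFrontier G)) := by
  refine mobiusMetric_le_log hcard.nonempty fun a ha b hb => ?_
  obtain ⟨a', b', rfl, rfl, hab⟩ := exists_dist_le_of_euclideanDiam_le hdiam hR ha hb
  have hpos := infDist_finiteFrontier_pos hG (finiteFrontier_nonempty hcard) hx
  have hratio : absoluteRatio (a' : MobiusSpace n) x b' OnePoint.infty =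
      dist a' b' / dist a' x := by
    change (dist a' b' * 1) / (dist a' x * 1) = _
    rw [mul_one, mul_one]
  rw [hratio]
  gcongr
  exact infDist_finiteFrontier_le x ha a' rfl

lemma mobiusMetric_coe_coe_le_log_add_log (hG : IsOpen G) (hcard : (frontier G).Nontrivial)
    {x y : Rn n} (hx : (x : MobiusSpace n) ∈ G) (hy : (y : MobiusSpace n) ∈ G) {R : ℝ} (hR : 0 ≤ R)
    (hdiam : dist x y ≤ R ∨ euclideanDiam (frontier G) ≤ ENNReal.ofReal R) :
    mobiusMetric G x y ≤ Real.log (1 + R / Metric.infDist x (finiteFrontier G)) +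
      Real.log (1 + R / Metric.infDist y (finiteFrontier G)) := by
  have hxpos := infDist_finiteFrontier_pos hG (finiteFrontier_nonempty hcard) hx
  have hypos := infDist_finiteFrontier_pos hG (finiteFrontier_nonempty hcard) hy
  rw [← Real.log_mul (by positivity) (by positivity)]
  exact mobiusMetric_le_log hcard.nonempty fun a ha b hb => one_add_absoluteRatio_le hxpos hypos
    (infDist_finiteFrontier_le x ha) (infDist_finiteFrontier_le y hb)
    (hdiam.imp_right fun h => exists_dist_le_of_euclideanDiam_le h hR ha hb)

theorem exists_log_le_modulusMetric (hn : 2 ≤ n) (hG : IsOpen G)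
    (hperfect : IsUniformlyPerfect (frontier G)) :
    ∃ κ : ℝ, 0 < κ ∧ ∀ {x : Rn n} {y : MobiusSpace n} {R : ℝ}, 0 < R →
      ENNReal.ofReal R ≤ euclideanDiam (frontier G) → (∀ z : Rn n, y = z → R ≤ dist z x) →
        ENNReal.ofReal (κ * Real.log (1 + R / Metric.infDist x (finiteFrontier G))) ≤
          modulusMetric G x y := by
  obtain ⟨-, hcard, c, hc, hc1, hring⟩ := hperfect
  obtain ⟨κ, hκ, hlog⟩ := JoiningConfiguration.exists_mul_log_le_lintegral hn hc hc1.le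
  refine ⟨κ, hκ, fun {x y R} hR hRD hfar => le_iInf₂ fun γ hγ => le_iInf₂ fun ρ hρ => ?_⟩
  have hxγ : (x : MobiusSpace n) ∈ range γ := ⟨0, γ.source⟩
  obtain ⟨a, ha, hxa⟩ := (isClosed_finiteFrontier G).exists_infDist_eq_dist
    (finiteFrontier_nonempty hcard) x
  rw [hxa]
  exact hlog
    { radius_pos := hR
      isClosed_set := isClosed_finiteFrontier G
      exists_mem_ring := fun q hq s hs hsR =>
        hring q hq s hs (((ENNReal.ofReal_lt_ofReal_iff hR).2 hsR).trans_le hRD)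
      isClosed_continuum := (isCompact_range γ.continuous).isClosed
      isPreconnected_continuum := isPreconnected_range γ.continuous
      source_mem := hxγ
      exists_far := ⟨y, ⟨1, γ.target⟩, hfar⟩
      center_mem := ha
      source_ne_center := fun h =>
        (disjoint_frontier_of_isOpen hG).notMem_of_mem_left (hγ hxγ) (h ▸ ha)
      measurable_density := hρ.1
      one_le_segmentIntegral_add := fun p hp q hq w =>
        one_le_segmentIntegral_add hG hγ hρ hp hq w }

theorem exists_le_modulusMetric_coe_infty (hn : 2 ≤ n) (hG : IsOpen G)
    (hperfect : IsUniformlyPerfect (frontier G)) :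
    ∃ b : ℝ, 0 < b ∧ ∀ x : Rn n, (x : MobiusSpace n) ∈ G → OnePoint.infty ∈ G →
      ENNReal.ofReal (b * mobiusMetric G x OnePoint.infty) ≤
        modulusMetric G x OnePoint.infty := by
  obtain ⟨κ, hκ, hlog⟩ := exists_log_le_modulusMetric hn hG hperfect
  refine ⟨κ, hκ, fun x hx hinf => ?_⟩
  set D := euclideanDiam (frontier G)
  have hDpos : 0 < D := euclideanDiam_pos hperfect.2.1
  have hDtop : D ≠ ⊤ := euclideanDiam_ne_top isClosed_frontier
    ((disjoint_frontier_of_isOpen hG).notMem_of_mem_left hinf)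
  calc _ ≤ ENNReal.ofReal
        (κ * Real.log (1 + D.toReal / Metric.infDist x (finiteFrontier G))) := by
        gcongr
        exact mobiusMetric_coe_infty_le_log hG hperfect.2.1 hx ENNReal.toReal_nonneg
          (ENNReal.ofReal_toReal hDtop).ge
    _ ≤ modulusMetric G x OnePoint.infty :=
        hlog (ENNReal.toReal_pos hDpos.ne' hDtop) ENNReal.ofReal_toReal_le
          fun z hz => absurd hz (OnePoint.infty_ne_coe z)

lemma exists_pos_ofReal_eq_min {d : ℝ} (hd : 0 < d) {D : ℝ≥0∞} (hD : 0 < D) :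
    ∃ R : ℝ, 0 < R ∧ ENNReal.ofReal R = min (ENNReal.ofReal d) D := by
  have htop : min (ENNReal.ofReal d) D ≠ ⊤ :=
    ((min_le_left _ _).trans_lt ENNReal.ofReal_lt_top).ne
  exact ⟨(min (ENNReal.ofReal d) D).toReal,
    ENNReal.toReal_pos (lt_min (ENNReal.ofReal_pos.2 hd) hD).ne' htop, ENNReal.ofReal_toReal htop⟩

theorem exists_le_modulusMetric_coe_coe (hn : 2 ≤ n) (hG : IsOpen G)
    (hperfect : IsUniformlyPerfect (frontier G)) :
    ∃ b : ℝ, 0 < b ∧ ∀ x y : Rn n, (x : MobiusSpace n) ∈ G → (y : MobiusSpace n) ∈ G → x ≠ y →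
      ENNReal.ofReal (b * mobiusMetric G x y) ≤ modulusMetric G x y := by
  obtain ⟨κ, hκ, hlog⟩ := exists_log_le_modulusMetric hn hG hperfect
  refine ⟨κ / 2, by positivity, fun x y hx hy hxy => ?_⟩
  obtain ⟨R, hR, hRmin⟩ := exists_pos_ofReal_eq_min (dist_pos.2 hxy)
    (euclideanDiam_pos hperfect.2.1)
  have hRdiam : ENNReal.ofReal R ≤ euclideanDiam (frontier G) := hRmin.trans_le (min_le_right _ _)
  have hRdist : R ≤ dist x y :=
    (ENNReal.ofReal_le_ofReal_iff dist_nonneg).1 (hRmin.trans_le (min_le_left _ _))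
  have hRalt : dist x y ≤ R ∨ euclideanDiam (frontier G) ≤ ENNReal.ofReal R := by
    rw [← ENNReal.ofReal_le_ofReal_iff hR.le, hRmin]
    exact (le_total _ _).imp (le_min le_rfl) (le_min · le_rfl)
  set A := Real.log (1 + R / Metric.infDist x (finiteFrontier G))
  set B := Real.log (1 + R / Metric.infDist y (finiteFrontier G))
  have hAB : mobiusMetric G x y ≤ A + B :=
    mobiusMetric_coe_coe_le_log_add_log hG hperfect.2.1 hx hy hR.le hRalt
  have hA : ENNReal.ofReal (κ * A) ≤ modulusMetric G x y := hlog hR hRdiam fun z hz => by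
    rwa [← OnePoint.coe_eq_coe.1 hz, dist_comm]
  have hB : ENNReal.ofReal (κ * B) ≤ modulusMetric G x y := by
    rw [modulusMetric_comm]
    exact hlog hR hRdiam fun z hz => by rwa [← OnePoint.coe_eq_coe.1 hz]
  rcases le_total A B with hle | hle
  · exact (ENNReal.ofReal_le_ofReal (by nlinarith)).trans hB
  · exact (ENNReal.ofReal_le_ofReal (by nlinarith)).trans hA

theorem exists_le_modulusMetric (hn : 2 ≤ n) (hG : IsOpen G)
    (hperfect : IsUniformlyPerfect (frontier G)) :
    ∃ b : ℝ, 0 < b ∧ ∀ x ∈ G, ∀ y ∈ G,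
      ENNReal.ofReal (b * mobiusMetric G x y) ≤ modulusMetric G x y := by
  obtain ⟨b₁, hb₁, hinfty⟩ := exists_le_modulusMetric_coe_infty hn hG hperfect
  obtain ⟨b₂, hb₂, hcoe⟩ := exists_le_modulusMetric_coe_coe hn hG hperfect
  have hmono : ∀ x y : MobiusSpace n, ∀ b, min b₁ b₂ ≤ b →
      ENNReal.ofReal (min b₁ b₂ * mobiusMetric G x y) ≤ ENNReal.ofReal (b * mobiusMetric G x y) :=
    fun x y b hb =>
      ENNReal.ofReal_le_ofReal (mul_le_mul_of_nonneg_right hb (mobiusMetric_nonneg G x y))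
  refine ⟨min b₁ b₂, lt_min hb₁ hb₂, fun x hx y hy => ?_⟩
  rcases eq_or_ne x y with rfl | hxy
  · rw [mobiusMetric_self, mul_zero, ENNReal.ofReal_zero]
    exact zero_le
  induction x using OnePoint.rec <;> induction y using OnePoint.rec
  case infty.infty => exact absurd rfl hxy
  case infty.coe y =>
    rw [mobiusMetric_comm, modulusMetric_comm]
    exact (hmono _ _ _ (min_le_left _ _)).trans (hinfty y hy hx)
  case coe.infty x => exact (hmono _ _ _ (min_le_left _ _)).trans (hinfty x hx hy)
  case coe.coe x y =>
    exact (hmono _ _ _ (min_le_right _ _)).trans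
      (hcoe x y hx hy (OnePoint.coe_injective.ne_iff.1 hxy))

end Direct

end

theorem mainTheorem2 (n : ℕ) (hn : 2 ≤ n) (G : Set (MobiusSpace n))
    (hG : IsMobiusDomain G) (hcard : (frontier G).Nontrivial) :
    IsUniformlyPerfect (frontier G) ↔
      ∃ b : ℝ, 0 < b ∧ ∀ x ∈ G, ∀ y ∈ G,
        ENNReal.ofReal (b * mobiusMetric G x y) ≤ modulusMetric G x y :=
  ⟨exists_le_modulusMetric hn hG.1, fun ⟨_, hb, h⟩ =>
    isUniformlyPerfect_frontier_of_le_modulusMetric hn hG hcard hb h⟩
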